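/- **Conventions.** Let $I=[0,1]$. A d-space is a topological space $X$ with a set $\vec P(X)$ of continuous paths $I\to X$ (the d-paths) that contains the constant paths and is closed under concatenation and under non-decreasing (not necessarily surjective) reparametrization; a d-map is a continuous map sending d-paths to d-paths; a d-homeomorphism is a homeomorphism that is a d-map together with its inverse. Real intervals carry the non-decreasing paths as d-paths ($\vec I$ for $I$), and products carry the paths with directed components. $\vec T(X)_x^y$ is the quotient space of the space of d-paths from $x$ to $y$ (compact-open topology) by the equivalence relation generated by $p\sim p\circ\varphi$, $\varphi:I\to I$ a continuous non-decreasing surjection; a d-map $f$ induces $\vec T(f):\vec T(X)_x^y\to\vec T(X)_{fx}^{fy}$, $[\sigma]\mapsto[f\circ\sigma]$. Let $\mathcal F$ be a class of continuous maps each of which induces a bijection on path components (for instance all weak homotopy equivalences, all maps inducing bijections on $\pi_0$, or all maps inducing isomorphisms on $H_n(-;G)$ for all $n\le k$, with $k\ge 0$ and an abelian group $G\ne0$). A d-map $f:X\to X$ is $\mathcal F$-psp if $\vec T(f):\vec T(X)_x^y\to\vec T(X)_{fx}^{fy}$ lies in $\mathcal F$ whenever there is a d-path from $x$ to $y$. It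 is $+\mathcal F$-inessential if there is a d-map $H:X\times\vec I\to X$ with $H_0=\mathrm{id}_X$, $H_1=f$ and every $H_t$ $\mathcal F$-psp. **The complex $D$.** $D$ is obtained from four unit squares $A,B_1,B_2,C$, whose points are written $[A;(x_1,x_2)]$ etc. with $(x_1,x_2)\in I^2$, by the identifications, for $t\in I$, $[A;(1,t)]=[B_1;(0,t)]$, $[A;(t,1)]=[B_2;(t,0)]$, $[B_1;(1,t)]=[C;(0,t)]$, $[B_2;(t,1)]=[C;(t,0)]$. A path in $D$ is a d-path if $I$ can be subdivided into finitely many intervals on each of which the path is given by a coordinatewise non-decreasing continuous path in one square. Put - $a_1=\{[A;(1,t)]: t<1\}$, $a_2=\{[A;(t,1)]: t<1\}$, $a^+=[A;(1,1)]$; - $b_1=\{[B_1;(t,1)]: t>0\}$, $b_2=\{[B_2;(1,t)]: t>0\}$; - $c_1=\{[C;(1,t)]: t<1\}$, $c_2=\{[C;(t,1)]: t<1\}$, $c^+=[C;(1,1)]$; - $\llcorner A=A\setminus(a_1\cup a_2\cup\{a^+\})$, $\lrcorner B_1=B_1\setminus(a_1\cup b_1\cup\{a^+\})$, $\ulcorner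 B_2=B_2\setminus(a_2\cup b_2\cup\{a^+\})$, $\llcorner C=C\setminus(c_1\cup c_2\cup\{c^+\})$. For $0\le u\le 2$ and $v\in I$ write $[B_1\cup C;(u,v)]$ for $[B_1;(u,v)]$ if $u\le1$ and for $[C;(u-1,v)]$ if $u\ge1$; for $u\in I$ and $0\le v\le 2$ write $[B_2\cup C;(u,v)]$ for $[B_2;(u,v)]$ if $v\le1$ and for $[C;(u,v-1)]$ if $v\ge1$. A map $f$ preserves $Y\subseteq D$ if $f(Y)\subseteq Y$. **Proposition.** Every $+\mathcal F$-inessential d-map $f:D\to D$ has the following properties. 1. $f$ preserves $A$, $a_1$, $a_2$, $\{a^+\}$, $D\setminus A$, $C$, $\lrcorner B_1\cup b_1\cup C$ and $\ulcorner B_2\cup b_2\cup C$. Moreover there are a map $\varphi:I^2\to I^2$, d-maps $f_1,f_2:\vec I\to\vec I$ and real numbers $d_1,d_2$ such that: 2. The restrictions of $f$ to $A$ and to $C$ agree: $f([A;x])=[A;\varphi(x)]$ and $f([C;x])=[C;\varphi(x)]$ for all $x\in I^2$. 3. $\varphi=f_1\times f_2$, and $t\le f_i(t)$ for all $t\in I$,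 $i=1,2$. 4. $0\le d_i<1$, and $f_i$ is a d-homeomorphism from $[0,1]$ onto $[d_i,1]$, $i=1,2$. 5. There are d-maps $g_i:I^2\to[0,1+d_i]$, $i=1,2$, with $g_1(0,t)=0=g_2(t,0)$, $g_1(1,t)=1+d_1$, $g_2(t,1)=1+d_2$ for all $t\in I$, and $s\le g_1(s,t)$, $t\le g_2(s,t)$ for all $s,t\in I$, such that for all $x_1,x_2\in I$ $$f([B_1;(x_1,x_2)])=[B_1\cup C;(g_1(x_1,x_2),f_2(x_2))],\qquad f([B_2;(x_1,x_2)])=[B_2\cup C;(f_1(x_1),g_2(x_1,x_2))].$$ Finally: 6. $f$ preserves $\llcorner A$, $\{c^+\}$, $b_1\cup c_2$, $b_2\cup c_1$, $\lrcorner B_1\cup\llcorner C$ and $\ulcorner B_2\cup\llcorner C$. -/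

import Mathlib

open CategoryTheory unitInterval

namespace DirectedTop

universe u v

/-! ## Directed spaces and directed maps -/

/-- A d-space: a topological space with a set of directed paths that contains the constant paths
and is closed under concatenation and under (not necessarily surjective) continuous
non-decreasing reparametrization. -/
class DSpace (X : Type u) [TopologicalSpace X] where
  dPaths : Set C(I, X)
  const_mem : ∀ x : X, ContinuousMap.const I x ∈ dPaths
  trans_mem : ∀ {x y z : X} (p : Path x y) (q : Path y z),
    p.toContinuousMap ∈ dPaths → q.toContinuousMap ∈ dPaths →
      (p.trans q).toContinuousMap ∈ dPaths
  reparam_mem : ∀ (p : C(I, X)) (φ : C(I, I)), Monotone φ → p ∈ dPaths → p.comp φ ∈ dPaths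

/-- The set of directed paths of a d-space. -/
def dPaths (X : Type u) [TopologicalSpace X] [DSpace X] : Set C(I, X) := DSpace.dPaths

/-- The directed real line: the directed paths are the non-decreasing ones. -/
instance : DSpace ℝ where
  dPaths := {p | Monotone p}
  const_mem x := fun _ _ _ => le_rfl
  trans_mem {x y z} p q hp hq := by
    intro s t hst
    have hp' : Monotone p := hp
    have hq' : Monotone q := hq
    have hst' : (s : ℝ) ≤ t := hst
    change (p.trans q) s ≤ (p.trans q) t
    rw [Path.trans_apply, Path.trans_apply]
    split_ifs with h1 h2 h2
    · exact hp' (Subtype.mk_le_mk.2 (by linarith))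
    · exact ((hp' le_top).trans_eq p.target).trans (q.source.symm.trans_le (hq' bot_le))
    · exact absurd (hst'.trans h2) h1
    · exact hq' (Subtype.mk_le_mk.2 (by linarith))
  reparam_mem p φ hφ hp := fun _ _ h => hp (hφ h)

/-- A subspace of a d-space: the directed paths are those which are directed in the big space.
In particular this makes the unit interval `I` the directed interval. -/
instance {X : Type u} [TopologicalSpace X] [DSpace X] (s : Set X) : DSpace s where
  dPaths := {p | (⟨Subtype.val, continuous_subtype_val⟩ : C(s, X)).comp p ∈ dPaths X}
  const_mem x := DSpace.const_mem (x : X)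
  trans_mem {x y z} p q hp hq := by
    have h := DSpace.trans_mem (p.map continuous_subtype_val) (q.map continuous_subtype_val) hp hq
    rw [← Path.map_trans] at h
    exact h
  reparam_mem p φ hφ hp := DSpace.reparam_mem _ φ hφ hp

/-- The product of two d-spaces: the directed paths are those with directed components. -/
instance {X : Type u} {Y : Type v} [TopologicalSpace X] [TopologicalSpace Y]
    [DSpace X] [DSpace Y] : DSpace (X × Y) where
  dPaths := {p | ContinuousMap.fst.comp p ∈ dPaths X ∧ ContinuousMap.snd.comp p ∈ dPaths Y}
  const_mem x := ⟨DSpace.const_mem x.1, DSpace.const_mem x.2⟩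
  trans_mem {x y z} p q hp hq := by
    constructor
    · have h := DSpace.trans_mem (p.map continuous_fst) (q.map continuous_fst) hp.1 hq.1
      rw [← Path.map_trans] at h
      exact h
    · have h := DSpace.trans_mem (p.map continuous_snd) (q.map continuous_snd) hp.2 hq.2
      rw [← Path.map_trans] at h
      exact h
  reparam_mem p φ hφ hp :=
    ⟨DSpace.reparam_mem _ φ hφ hp.1, DSpace.reparam_mem _ φ hφ hp.2⟩

/-- A d-map: a continuous map which sends directed paths to directed paths. -/
structure DMap (X : Type u) (Y : Type v) [TopologicalSpace X] [TopologicalSpace Y]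
    [DSpace X] [DSpace Y] where
  toMap : C(X, Y)
  map_dPaths : ∀ p ∈ dPaths X, toMap.comp p ∈ dPaths Y

instance {X : Type u} {Y : Type v} [TopologicalSpace X] [TopologicalSpace Y]
    [DSpace X] [DSpace Y] : CoeFun (DMap X Y) (fun _ => X → Y) := ⟨fun f => f.toMap⟩

/-- A d-homeomorphism: a homeomorphism which is a d-map and whose inverse is a d-map. -/
structure DHomeo (X : Type u) (Y : Type v) [TopologicalSpace X] [TopologicalSpace Y]
    [DSpace X] [DSpace Y] where
  toHomeo : X ≃ₜ Y
  map_dPaths : ∀ p ∈ dPaths X, (toHomeo : C(X, Y)).comp p ∈ dPaths Y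
  symm_map_dPaths : ∀ p ∈ dPaths Y, (toHomeo.symm : C(Y, X)).comp p ∈ dPaths X

/-! ## Trace spaces -/

section Traces

variable {X : Type u} {Y : Type v} [TopologicalSpace X] [TopologicalSpace Y] [DSpace X] [DSpace Y]

/-- The space of directed paths from `x` to `y`, with the compact-open topology. -/
abbrev DPath (x y : X) : Type u := {p : C(I, X) // p ∈ dPaths X ∧ p 0 = x ∧ p 1 = y}

/-- `q` is a reparametrization of `p` by a non-decreasing continuous surjection of `I`. -/
def IsReparam {x y : X} (p q : DPath x y) : Prop :=
  ∃ φ : C(I, I), Monotone φ ∧ Function.Surjective φ ∧ q.1 = p.1.comp φ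

/-- The trace space from `x` to `y`: the quotient, with the quotient topology, of the space of
directed paths by the equivalence relation generated by reparametrization. -/
abbrev Trace (x y : X) : Type u := Quot (IsReparam (x := x) (y := y))

/-- The map of path spaces `σ ↦ f ∘ σ` induced by a d-map. -/
def DMap.pathMap (f : DMap X Y) (x y : X) : C(DPath x y, DPath (f x) (f y)) where
  toFun p := ⟨f.toMap.comp p.1, f.map_dPaths _ p.2.1,
    congrArg f.toMap p.2.2.1, congrArg f.toMap p.2.2.2⟩
  continuous_toFun := by
    refine Continuous.subtype_mk ?_ _
    exact (ContinuousMap.continuous_postcomp f.toMap).comp continuous_subtype_val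

/-- The map of trace spaces `[σ] ↦ [f ∘ σ]` induced by a d-map. -/
def DMap.traceMap (f : DMap X Y) (x y : X) : C(Trace x y, Trace (f x) (f y)) where
  toFun := Quot.map (f.pathMap x y) (by
    rintro p q ⟨φ, h1, h2, h3⟩
    exact ⟨φ, h1, h2, congrArg f.toMap.comp h3⟩)
  continuous_toFun :=
    continuous_quot_lift _ (continuous_quot_mk.comp (f.pathMap x y).continuous)

end Traces

/-! ## Path space preserving maps, homotopy flows, inessential maps -/

/-- The map induced on path components by a continuous map. -/
def zerothHomotopyMap {X Y : Type u} [TopologicalSpace X] [TopologicalSpace Y] (f : C(X, Y)) :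
    ZerothHomotopy X → ZerothHomotopy Y :=
  ZerothHomotopy.lift (ZerothHomotopy.mk ∘ f)
    (fun _ _ p => ZerothHomotopy.sound (p.map f.continuous))

/-- The class of all continuous maps which induce a bijection on path components. -/
def pi0Bijective : MorphismProperty TopCat.{u} :=
  fun _ _ f => Function.Bijective (zerothHomotopyMap f.hom)

section Inessential

variable {X : Type u} [TopologicalSpace X] [DSpace X]

/-- A d-map is path space preserving with respect to a class `F` of continuous maps if it induces
a map in `F` on the trace space of every reachable pair of points. -/
def IsPsp (F : MorphismProperty TopCat.{u}) (f : DMap X X) : Prop :=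
  ∀ x y : X, Nonempty (DPath x y) →
    F (TopCat.ofHom (f.traceMap x y) :
      TopCat.of (Trace x y) ⟶ TopCat.of (Trace (f x) (f y)))

/-- The level map `x ↦ H (x, t)` of a d-homotopy `H`. -/
def DMap.level (H : DMap (X × I) X) (t : I) : DMap X X where
  toMap := H.toMap.comp ((ContinuousMap.id X).prodMk (ContinuousMap.const X t))
  map_dPaths p hp := H.map_dPaths (p.prodMk (ContinuousMap.const I t))
    ⟨hp, DSpace.const_mem t⟩

/-- `f` is future `F`-inessential: there is a d-map `H : X × I → X` (where `I` is the directed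
interval) from the identity to `f` all of whose level maps are path space preserving. -/
def IsFutureInessential (F : MorphismProperty TopCat.{u}) (f : DMap X X) : Prop :=
  ∃ H : DMap (X × I) X,
    (∀ x, H (x, 0) = x) ∧ (∀ x, H (x, 1) = f x) ∧ ∀ t, IsPsp F (H.level t)

end Inessential

/-! ## Dubut's complex -/

/-- The four 2-cells. -/
inductive Cell
  | A | B₁ | B₂ | C

instance : TopologicalSpace Cell := ⊥

instance : DiscreteTopology Cell := ⟨rfl⟩

/-- The face identifications of the four unit squares: the right edge of `A` is the left edge of
`B₁`, the top edge of `A` is the bottom edge of `B₂`, the right edge of `B₁` is the left edge of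
`C`, and the top edge of `B₂` is the bottom edge of `C`. -/
inductive Glue : Cell × (I × I) → Cell × (I × I) → Prop
  | AB₁ (t : I) : Glue (.A, (1, t)) (.B₁, (0, t))
  | AB₂ (t : I) : Glue (.A, (t, 1)) (.B₂, (t, 0))
  | B₁C (t : I) : Glue (.B₁, (1, t)) (.C, (0, t))
  | B₂C (t : I) : Glue (.B₂, (t, 1)) (.C, (t, 0))

/-- Dubut's complex, with the quotient topology. -/
def Dubut : Type := Quot Glue

instance : TopologicalSpace Dubut := inferInstanceAs (TopologicalSpace (Quot Glue))

/-- The point `[c; x]` of Dubut's complex with coordinates `x` in the cell `c`. -/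
def pt (c : Cell) (x : I × I) : Dubut := Quot.mk Glue (c, x)

/-- The path `γ` is, on the interval `[a, b]`, given by a non-decreasing path in one cell. -/
def CellStep (γ : C(I, Dubut)) (a b : I) : Prop :=
  ∃ (c : Cell) (p : I → I × I), ContinuousOn p (Set.Icc a b) ∧ MonotoneOn p (Set.Icc a b) ∧
    ∀ s ∈ Set.Icc a b, γ s = pt c (p s)

/-- Directed paths in the complex: for some subdivision `0 = t₀ ≤ t₁ ≤ ⋯ ≤ tₖ = 1` the path is
on each interval `[tᵢ, tᵢ₊₁]` a non-decreasing path in one cell. (Every cell is a face of a 2-cell,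
so it suffices to consider paths in 2-cells.) -/
def IsCellwiseMonotone (γ : C(I, Dubut)) : Prop :=
  ∃ (k : ℕ) (t : ℕ → I), Monotone t ∧ t 0 = 0 ∧ t k = 1 ∧ ∀ i < k, CellStep γ (t i) (t (i + 1))

lemma CellStep.refl (γ : C(I, Dubut)) (a : I) : CellStep γ a a := by
  obtain ⟨⟨c, x⟩, hx⟩ := Quot.exists_rep (γ a)
  refine ⟨c, fun _ => x, continuousOn_const, fun _ _ _ _ _ => le_rfl, fun s hs => ?_⟩
  obtain rfl : s = a := le_antisymm hs.2 hs.1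
  exact hx.symm

lemma CellStep.mono {γ : C(I, Dubut)} {a b a' b' : I} (h : CellStep γ a b) (ha : a ≤ a')
    (hb : b' ≤ b) : CellStep γ a' b' := by
  obtain ⟨c, p, h1, h2, h3⟩ := h
  have hs : Set.Icc a' b' ⊆ Set.Icc a b := Set.Icc_subset_Icc ha hb
  exact ⟨c, p, h1.mono hs, h2.mono hs, fun s h => h3 s (hs h)⟩

lemma CellStep.comp {γ : C(I, Dubut)} {φ : C(I, I)} (hφ : Monotone φ) {a b : I}
    (h : CellStep γ (φ a) (φ b)) : CellStep (γ.comp φ) a b := by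
  obtain ⟨c, p, h1, h2, h3⟩ := h
  have hs : Set.MapsTo φ (Set.Icc a b) (Set.Icc (φ a) (φ b)) :=
    fun s h => ⟨hφ h.1, hφ h.2⟩
  exact ⟨c, p ∘ φ, h1.comp φ.continuous.continuousOn hs,
    fun s hs' t ht hst => h2 (hs hs') (hs ht) (hφ hst), fun s h => h3 _ (hs h)⟩

/-- Ordered cell steps, used only to check the laws of a d-space. -/
def OrdStep (γ : C(I, Dubut)) (a b : I) : Prop := a ≤ b ∧ CellStep γ a b

lemma isCellwiseMonotone_iff (γ : C(I, Dubut)) :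
    IsCellwiseMonotone γ ↔ Relation.ReflTransGen (OrdStep γ) 0 1 := by
  constructor
  · rintro ⟨k, t, ht, h0, h1, hs⟩
    have key : ∀ i ≤ k, Relation.ReflTransGen (OrdStep γ) (t 0) (t i) := by
      intro i
      induction i with
      | zero => exact fun _ => .refl
      | succ i ih =>
        exact fun hi => (ih (by omega)).tail ⟨ht (Nat.le_succ i), hs i (by omega)⟩
    have := key k le_rfl
    rwa [h0, h1] at this
  · intro h
    suffices H : ∀ b, Relation.ReflTransGen (OrdStep γ) 0 b → ∃ (k : ℕ) (t : ℕ → I),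
        Monotone t ∧ t 0 = 0 ∧ t k = b ∧ ∀ i < k, CellStep γ (t i) (t (i + 1)) from H 1 h
    intro b hb
    induction hb with
    | refl => exact ⟨0, fun _ => 0, fun _ _ _ => le_rfl, rfl, rfl, fun i hi => by omega⟩
    | @tail b c _ hbc ih =>
      obtain ⟨k, t, ht, h0, h1, hs⟩ := ih
      refine ⟨k + 1, fun i => if i ≤ k then t i else c, ?_, by simp [h0], by simp, ?_⟩
      · refine monotone_nat_of_le_succ fun i => ?_
        by_cases h : i + 1 ≤ k
        · rw [if_pos (by omega : i ≤ k), if_pos h]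
          exact ht (Nat.le_succ i)
        · rw [if_neg h]
          by_cases h' : i ≤ k
          · rw [if_pos h']
            exact (ht h').trans (h1.trans_le hbc.1)
          · rw [if_neg h']
      · intro i hi
        by_cases h : i + 1 ≤ k
        · simpa [h, (by omega : i ≤ k)] using hs i (by omega)
        · obtain rfl : i = k := by omega
          simpa [h1] using hbc.2

lemma ordSteps_le {γ : C(I, Dubut)} {a b : I} (h : Relation.ReflTransGen (OrdStep γ) a b) :
    a ≤ b := by
  induction h with
  | refl => exact le_rfl
  | tail _ h ih => exact ih.trans h.1

lemma ordSteps_restrict {γ : C(I, Dubut)} {a b : I} (h : Relation.ReflTransGen (OrdStep γ) a b) :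
    ∀ a' b', a ≤ a' → a' ≤ b' → b' ≤ b → Relation.ReflTransGen (OrdStep γ) a' b' := by
  induction h with
  | refl =>
    intro a' b' h1 h2 h3
    obtain rfl : a' = b' := le_antisymm h2 (h3.trans h1)
    exact .refl
  | @tail b c _ hbc ih =>
    intro a' b' h1 h2 h3
    rcases le_total b' b with h | h
    · exact ih a' b' h1 h2 h
    · rcases le_total a' b with h' | h'
      · exact (ih a' b h1 h' le_rfl).tail ⟨h, hbc.2.mono le_rfl h3⟩
      · exact .single ⟨h2, hbc.2.mono h' h3⟩

lemma ordSteps_comp {γ : C(I, Dubut)} {φ : C(I, I)} (hφ : Monotone φ) {x y : I}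
    (h : Relation.ReflTransGen (OrdStep γ) x y) :
    ∀ a b, a ≤ b → φ a = x → φ b = y → Relation.ReflTransGen (OrdStep (γ.comp φ)) a b := by
  induction h with
  | refl =>
    intro a b hab ha hb
    refine .single ⟨hab, CellStep.comp hφ ?_⟩
    rw [ha, hb]
    exact CellStep.refl γ x
  | @tail y z hxy hyz ih =>
    intro a b hab ha hb
    obtain ⟨c, hc, hcy⟩ : y ∈ φ '' Set.Icc a b :=
      intermediate_value_Icc hab φ.continuous.continuousOn
        ⟨ha.trans_le (ordSteps_le hxy), hyz.1.trans_eq hb.symm⟩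
    exact (ih a c hc.1 ha hcy).tail
      ⟨hc.2, CellStep.comp hφ (by rw [hcy, hb]; exact hyz.2)⟩

lemma CellStep.congr {γ γ' : C(I, Dubut)} {a b : I} (h : CellStep γ a b)
    (e : ∀ s ∈ Set.Icc a b, γ' s = γ s) : CellStep γ' a b := by
  obtain ⟨c, p, h1, h2, h3⟩ := h
  exact ⟨c, p, h1, h2, fun s hs => (e s hs).trans (h3 s hs)⟩

lemma ordSteps_congr {γ γ' : C(I, Dubut)} {a b : I} (h : Relation.ReflTransGen (OrdStep γ) a b) :
    (∀ s ∈ Set.Icc a b, γ' s = γ s) → Relation.ReflTransGen (OrdStep γ') a b := by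
  induction h with
  | refl => exact fun _ => .refl
  | @tail b c hab hbc ih =>
    intro e
    exact (ih fun s hs => e s ⟨hs.1, hs.2.trans hbc.1⟩).tail
      ⟨hbc.1, hbc.2.congr fun s hs => e s ⟨(ordSteps_le hab).trans hs.1, hs.2⟩⟩

/-- Dubut's complex as a d-space. -/
instance : DSpace Dubut where
  dPaths := {γ | IsCellwiseMonotone γ}
  const_mem x := by
    refine (isCellwiseMonotone_iff _).2 (.single ⟨zero_le_one, ?_⟩)
    obtain ⟨⟨c, y⟩, hy⟩ := Quot.exists_rep x
    exact ⟨c, fun _ => y, continuousOn_const, fun _ _ _ _ _ => le_rfl, fun s _ => hy.symm⟩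
  trans_mem {x y z} p q hp hq := by
    have hp' := (isCellwiseMonotone_iff _).1 hp
    have hq' := (isCellwiseMonotone_iff _).1 hq
    let h : I := ⟨1 / 2, by norm_num, by norm_num⟩
    let φ : C(I, I) := ⟨fun s => Set.projIcc 0 1 zero_le_one (2 * (s : ℝ)),
      continuous_projIcc.comp (by fun_prop)⟩
    let ψ : C(I, I) := ⟨fun s => Set.projIcc 0 1 zero_le_one (2 * (s : ℝ) - 1),
      continuous_projIcc.comp (by fun_prop)⟩
    have hφ : Monotone φ := fun s t hst =>
      Set.monotone_projIcc zero_le_one (by have : (s : ℝ) ≤ t := hst; linarith)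
    have hψ : Monotone ψ := fun s t hst =>
      Set.monotone_projIcc zero_le_one (by have : (s : ℝ) ≤ t := hst; linarith)
    have e0 : φ 0 = 0 := Set.projIcc_of_le_left zero_le_one (by norm_num)
    have e1 : φ h = 1 := Set.projIcc_of_right_le zero_le_one (by norm_num [h])
    have e2 : ψ h = 0 := Set.projIcc_of_le_left zero_le_one (by norm_num [h])
    have e3 : ψ 1 = 1 := Set.projIcc_of_right_le zero_le_one (by norm_num)
    have s1 := ordSteps_comp hφ hp' 0 h bot_le e0 e1
    have s2 := ordSteps_comp hψ hq' h 1 le_top e2 e3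
    refine (isCellwiseMonotone_iff _).2 ((ordSteps_congr s1 ?_).trans (ordSteps_congr s2 ?_))
    · intro s hs
      have hs' : (s : ℝ) ≤ 1 / 2 := hs.2
      change (p.trans q) s = p (Set.projIcc 0 1 zero_le_one (2 * (s : ℝ)))
      rw [Path.trans_apply, dif_pos hs', Set.projIcc_of_mem]
    · intro s hs
      have hs' : 1 / 2 ≤ (s : ℝ) := hs.1
      change (p.trans q) s = q (Set.projIcc 0 1 zero_le_one (2 * (s : ℝ) - 1))
      rw [Path.trans_apply]
      split_ifs with hh
      · have hs2 : (s : ℝ) = 1 / 2 := le_antisymm hh hs'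
        rw [Set.projIcc_of_le_left zero_le_one (by rw [hs2]; norm_num)]
        have : (⟨2 * (s : ℝ), (unitInterval.mul_pos_mem_iff zero_lt_two).2 ⟨s.2.1, hh⟩⟩ : I) = 1 :=
          Subtype.ext (by simp [hs2])
        rw [this]
        exact p.target.trans q.source.symm
      · rw [Set.projIcc_of_mem]
  reparam_mem p φ hφ hp := by
    refine (isCellwiseMonotone_iff _).2 ?_
    refine ordSteps_comp hφ ?_ 0 1 zero_le_one rfl rfl
    exact ordSteps_restrict ((isCellwiseMonotone_iff _).1 hp) _ _ bot_le (hφ zero_le_one) le_top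

/-! ## Regions of the complex -/

/-- The closed 2-cell `c`, as a subset of the complex. -/
def cell (c : Cell) : Set Dubut := Set.range (pt c)

def a₁ : Set Dubut := {x | ∃ t : I, t < 1 ∧ x = pt .A (1, t)}

def a₂ : Set Dubut := {x | ∃ t : I, t < 1 ∧ x = pt .A (t, 1)}

def aPlus : Dubut := pt .A (1, 1)

/-- The cell `A` without its upper boundary. -/
def openA : Set Dubut := cell .A \ (a₁ ∪ a₂ ∪ {aPlus})

def b₁ : Set Dubut := {x | ∃ t : I, 0 < t ∧ x = pt .B₁ (t, 1)}

def b₂ : Set Dubut := {x | ∃ t : I, 0 < t ∧ x = pt .B₂ (1, t)}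

/-- The cell `B₁` without its left and top edges. -/
def openB₁ : Set Dubut := cell .B₁ \ (a₁ ∪ b₁ ∪ {aPlus})

/-- The cell `B₂` without its bottom and right edges. -/
def openB₂ : Set Dubut := cell .B₂ \ (a₂ ∪ b₂ ∪ {aPlus})

def c₁ : Set Dubut := {x | ∃ t : I, t < 1 ∧ x = pt .C (1, t)}

def c₂ : Set Dubut := {x | ∃ t : I, t < 1 ∧ x = pt .C (t, 1)}

def cPlus : Dubut := pt .C (1, 1)

/-- The cell `C` without its upper boundary. -/
def openC : Set Dubut := cell .C \ (c₁ ∪ c₂ ∪ {cPlus})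

/-- The point `[B₁ ∪ C; (u, v)]`, for `0 ≤ u ≤ 2`, of the rectangle `[0, 2] × [0, 1]` that is
obtained by placing `C` to the right of `B₁`. -/
noncomputable def ptB₁C (u : ℝ) (v : I) : Dubut :=
  if u ≤ 1 then pt .B₁ (Set.projIcc 0 1 zero_le_one u, v)
  else pt .C (Set.projIcc 0 1 zero_le_one (u - 1), v)

/-- The point `[B₂ ∪ C; (u, v)]`, for `0 ≤ v ≤ 2`, of the rectangle `[0, 1] × [0, 2]` that is
obtained by placing `C` on top of `B₂`. -/
noncomputable def ptB₂C (u : I) (v : ℝ) : Dubut :=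
  if v ≤ 1 then pt .B₂ (u, Set.projIcc 0 1 zero_le_one v)
  else pt .C (u, Set.projIcc 0 1 zero_le_one (v - 1))

/-- `f` preserves the subset `Y`, that is, `f(Y) ⊆ Y`. -/
def Preserves (f : DMap Dubut Dubut) (Y : Set Dubut) : Prop := Set.MapsTo f Y Y

end DirectedTop

namespace DirectedTop

namespace Dubut

/-! ## Coordinate functions on the complex -/

/-! A d-path from `A` to `C` must choose between `B₁` and `B₂`. Both choices are possible from
`[A;x]` to `[C;y]` exactly when `x ≤ y` coordinatewise, and they then lie in different components of
the trace space (`not_traceConnected`). If only one choice is possible, or the path starts outside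
`A`, a straight-line homotopy in the row `A`, `B₁`, `C` or its mirror image shows that the trace
space has at most one component (`traceConnected_of_lt`, `traceConnected_of_height_pos`). Since maps
in `F` are bijective on path components, an inessential map `f` preserves and reflects this
dichotomy. The flow moreover gives a d-path from each `z` to `f z`, so coordinates can only grow.

These facts are rigid enough to determine `f`. The vertex `cPlus` is fixed because it is maximal,
and `A` consists of the points whose trace space to `cPlus` is disconnected, so `f` preserves both
`A` and its complement. For the first coordinate, `f` carries `x.1 ≤ y.1` between `A` and `C` to the
corresponding inequality (`coord₁_A_le_C`). It also carries `y.1 < x.1` to a strict inequality,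
provided `x.2 ≤ y.2`, because connectedness must survive (`coord₁_C_lt_A`). Letting `x.1` decrease
to `y.1` squeezes the two (`coord₁_C_eq_A`): the first coordinate of `f` is the same function of the
first coordinate on `A` and on `C`, independent of the second, and strictly increasing. On `B₁` the
second coordinate is trapped between its equal values on the two vertical edges (`map_B₁_eq`). The
symmetry `swap` supplies all statements with the indices exchanged. -/

/-- A function on the complex is given by four functions on the cells which agree on the glued
edges. -/
def lift {α : Type*} (g : Cell → I × I → α) (hAB₁ : ∀ t, g .A (1, t) = g .B₁ (0, t))
    (hAB₂ : ∀ t, g .A (t, 1) = g .B₂ (t, 0)) (hB₁C : ∀ t, g .B₁ (1, t) = g .C (0, t))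
    (hB₂C : ∀ t, g .B₂ (t, 1) = g .C (t, 0)) : Dubut → α :=
  Quot.lift (fun x => g x.1 x.2) (by
    rintro _ _ (t | t | t | t)
    exacts [hAB₁ t, hAB₂ t, hB₁C t, hB₂C t])

lemma continuous_lift {α : Type*} [TopologicalSpace α] (g : Cell → I × I → α) {hAB₁ hAB₂ hB₁C hB₂C}
    (hg : ∀ c, Continuous (g c)) : Continuous (lift g hAB₁ hAB₂ hB₁C hB₂C) :=
  continuous_quot_lift _ (continuous_prod_of_discrete_left.2 hg)

lemma continuous_pt (c : Cell) : Continuous (pt c) :=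
  continuous_quot_mk.comp (by fun_prop : Continuous fun x : I × I => (c, x))

lemma glue_AB₁ (t : I) : pt .A (1, t) = pt .B₁ (0, t) := Quot.sound (.AB₁ t)
lemma glue_AB₂ (t : I) : pt .A (t, 1) = pt .B₂ (t, 0) := Quot.sound (.AB₂ t)
lemma glue_B₁C (t : I) : pt .B₁ (1, t) = pt .C (0, t) := Quot.sound (.B₁C t)
lemma glue_B₂C (t : I) : pt .B₂ (t, 1) = pt .C (t, 0) := Quot.sound (.B₂C t)

lemma exists_pt (z : Dubut) : ∃ c x, z = pt c x := by
  obtain ⟨⟨c, x⟩, rfl⟩ := Quot.exists_rep z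
  exact ⟨c, x, rfl⟩

/-- How far a point has advanced from `A` (height `0`) to `C` (height `1`). -/
def height : Dubut → ℝ :=
  lift (fun | .A, _ => 0 | .B₁, x => x.1 | .B₂, x => x.2 | .C, _ => 1)
    (by simp) (by simp) (by simp) (by simp)

/-- A function which is positive inside `B₁`, negative inside `B₂` and zero on `A` and `C`. -/
def side : Dubut → ℝ :=
  lift (fun | .A, _ => 0 | .B₁, x => x.1 * (1 - x.1) | .B₂, x => - (x.2 * (1 - x.2)) | .C, _ => 0)
    (by simp) (by simp) (by simp) (by simp)

/-- A directed function extending the first coordinate along the row `A`, `B₁`, `C`. -/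
def coord₁ : Dubut → ℝ :=
  -- On `B₂` the factor 2 interpolates between `x.1` on the edge shared with `A` and `2 + x.1` on
  -- the edge shared with `C`.
  lift (fun | .A, x => x.1 | .B₁, x => 1 + x.1 | .B₂, x => x.1 + 2 * x.2 | .C, x => 2 + x.1)
    (by simp) (by simp) (by simp; norm_num) (by simp [add_comm])

/-- A directed function extending the second coordinate along the column `A`, `B₂`, `C`. -/
def coord₂ : Dubut → ℝ :=
  lift (fun | .A, x => x.2 | .B₁, x => x.2 + 2 * x.1 | .B₂, x => 1 + x.2 | .C, x => 2 + x.2)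
    (by simp) (by simp) (by simp [add_comm]) (by simp; norm_num)

section
variable (x : I × I)
@[simp] lemma height_A : height (pt .A x) = 0 := rfl
@[simp] lemma height_B₁ : height (pt .B₁ x) = x.1 := rfl
@[simp] lemma height_B₂ : height (pt .B₂ x) = x.2 := rfl
@[simp] lemma height_C : height (pt .C x) = 1 := rfl
@[simp] lemma side_A : side (pt .A x) = 0 := rfl
@[simp] lemma side_B₁ : side (pt .B₁ x) = x.1 * (1 - x.1) := rfl
@[simp] lemma side_B₂ : side (pt .B₂ x) = - (x.2 * (1 - x.2)) := rfl
@[simp] lemma side_C : side (pt .C x) = 0 := rfl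
@[simp] lemma coord₁_A : coord₁ (pt .A x) = x.1 := rfl
@[simp] lemma coord₁_B₁ : coord₁ (pt .B₁ x) = 1 + x.1 := rfl
@[simp] lemma coord₁_B₂ : coord₁ (pt .B₂ x) = x.1 + 2 * x.2 := rfl
@[simp] lemma coord₁_C : coord₁ (pt .C x) = 2 + x.1 := rfl
@[simp] lemma coord₂_A : coord₂ (pt .A x) = x.2 := rfl
@[simp] lemma coord₂_B₁ : coord₂ (pt .B₁ x) = x.2 + 2 * x.1 := rfl
@[simp] lemma coord₂_B₂ : coord₂ (pt .B₂ x) = 1 + x.2 := rfl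
@[simp] lemma coord₂_C : coord₂ (pt .C x) = 2 + x.2 := rfl
end

@[fun_prop] lemma continuous_height : Continuous height :=
  continuous_lift _ (by rintro (_ | _ | _ | _) <;> dsimp only <;> fun_prop)

@[fun_prop] lemma continuous_side : Continuous side :=
  continuous_lift _ (by rintro (_ | _ | _ | _) <;> dsimp only <;> fun_prop)

@[fun_prop] lemma continuous_coord₁ : Continuous coord₁ :=
  continuous_lift _ (by rintro (_ | _ | _ | _) <;> dsimp only <;> fun_prop)

@[fun_prop] lemma continuous_coord₂ : Continuous coord₂ :=
  continuous_lift _ (by rintro (_ | _ | _ | _) <;> dsimp only <;> fun_prop)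

lemma height_nonneg (z : Dubut) : 0 ≤ height z := by
  obtain ⟨c, x, rfl⟩ := exists_pt z
  cases c <;> simp [x.1.2.1, x.2.2.1]

lemma height_le_one (z : Dubut) : height z ≤ 1 := by
  obtain ⟨c, x, rfl⟩ := exists_pt z
  cases c <;> simp [x.1.2.2, x.2.2.2]

lemma side_eq_zero_iff (z : Dubut) : side z = 0 ↔ height z = 0 ∨ height z = 1 := by
  obtain ⟨c, x, rfl⟩ := exists_pt z
  cases c <;> simp [sub_eq_zero, eq_comm (a := (1 : ℝ))]

lemma height_eq_zero_iff {z : Dubut} : height z = 0 ↔ ∃ x, z = pt .A x := by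
  refine ⟨fun h => ?_, by rintro ⟨x, rfl⟩; rfl⟩
  obtain ⟨c, ⟨u, v⟩, rfl⟩ := exists_pt z
  cases c
  · exact ⟨_, rfl⟩
  · obtain rfl : u = 0 := Subtype.ext h
    exact ⟨_, (glue_AB₁ v).symm⟩
  · obtain rfl : v = 0 := Subtype.ext h
    exact ⟨_, (glue_AB₂ u).symm⟩
  · norm_num at h

lemma height_eq_one_iff {z : Dubut} : height z = 1 ↔ ∃ x, z = pt .C x := by
  refine ⟨fun h => ?_, by rintro ⟨x, rfl⟩; rfl⟩
  obtain ⟨c, ⟨u, v⟩, rfl⟩ := exists_pt z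
  cases c
  · norm_num at h
  · obtain rfl : u = 1 := Subtype.ext h
    exact ⟨_, glue_B₁C v⟩
  · obtain rfl : v = 1 := Subtype.ext h
    exact ⟨_, glue_B₂C u⟩
  · exact ⟨_, rfl⟩

/-- The points where `side` is non-negative are those of the row `A`, `B₁`, `C`. -/
lemma cases_of_side_nonneg {z : Dubut} (h : 0 ≤ side z) :
    (∃ x, z = pt .A x) ∨ (∃ x, z = pt .B₁ x) ∨ ∃ x, z = pt .C x := by
  obtain ⟨c, ⟨u, v⟩, rfl⟩ := exists_pt z
  cases c
  · exact .inl ⟨_, rfl⟩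
  · exact .inr (.inl ⟨_, rfl⟩)
  · have h0 : side (pt .B₂ (u, v)) = 0 := by
      refine le_antisymm ?_ h
      have := mul_nonneg v.2.1 (sub_nonneg.2 v.2.2)
      simpa using this
    rcases (side_eq_zero_iff _).1 h0 with h1 | h1
    · exact .inl (height_eq_zero_iff.1 h1)
    · exact .inr (.inr (height_eq_one_iff.1 h1))
  · exact .inr (.inr ⟨_, rfl⟩)

/-! ## The symmetry of the complex -/

/-- The symmetry of the complex which exchanges `B₁` and `B₂`. -/
def swap : Dubut → Dubut :=
  lift (fun | .A, x => pt .A x.swap | .B₁, x => pt .B₂ x.swap | .B₂, x => pt .B₁ x.swap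
            | .C, x => pt .C x.swap)
    glue_AB₂ glue_AB₁ glue_B₂C glue_B₁C

/-- The symmetry on cells. -/
def _root_.DirectedTop.Cell.swap : Cell → Cell
  | .A => .A | .B₁ => .B₂ | .B₂ => .B₁ | .C => .C

lemma swap_pt (c : Cell) (x : I × I) : swap (pt c x) = pt c.swap x.swap := by
  cases c <;> rfl

@[simp] lemma swap_A (x : I × I) : swap (pt .A x) = pt .A x.swap := rfl
@[simp] lemma swap_B₁ (x : I × I) : swap (pt .B₁ x) = pt .B₂ x.swap := rfl
@[simp] lemma swap_B₂ (x : I × I) : swap (pt .B₂ x) = pt .B₁ x.swap := rfl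
@[simp] lemma swap_C (x : I × I) : swap (pt .C x) = pt .C x.swap := rfl

@[fun_prop] lemma continuous_swap : Continuous swap :=
  continuous_lift _ (by
    rintro (_ | _ | _ | _)
    all_goals exact (continuous_pt _).comp _root_.continuous_swap)

@[simp] lemma swap_swap (z : Dubut) : swap (swap z) = z := by
  obtain ⟨c, x, rfl⟩ := exists_pt z
  cases c <;> rfl

@[simp] lemma height_swap (z : Dubut) : height (swap z) = height z := by
  obtain ⟨c, x, rfl⟩ := exists_pt z
  cases c <;> rfl

@[simp] lemma coord₁_swap (z : Dubut) : coord₁ (swap z) = coord₂ z := by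
  obtain ⟨c, x, rfl⟩ := exists_pt z
  cases c <;> rfl

@[simp] lemma coord₂_swap (z : Dubut) : coord₂ (swap z) = coord₁ z := by
  obtain ⟨c, x, rfl⟩ := exists_pt z
  cases c <;> rfl

@[simp] lemma side_swap (z : Dubut) : side (swap z) = - side z := by
  obtain ⟨c, x, rfl⟩ := exists_pt z
  cases c <;> simp

/-- The symmetry as a d-map. -/
def swapDMap : DMap Dubut Dubut where
  toMap := ⟨swap, continuous_swap⟩
  map_dPaths := by
    rintro γ ⟨k, t, ht, h0, h1, hs⟩
    refine ⟨k, t, ht, h0, h1, fun i hi => ?_⟩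
    obtain ⟨c, p, hp, hm, he⟩ := hs i hi
    refine ⟨c.swap, fun s => (p s).swap, _root_.continuous_swap.comp_continuousOn hp,
      fun a ha b hb hab => Prod.swap_le_swap.2 (hm ha hb hab), fun s hs => ?_⟩
    exact (congrArg swap (he s hs)).trans (swap_pt c (p s))

/-! ## Monotone quantities along directed paths -/

lemma ordSteps_of_dPath {γ : C(I, Dubut)} (h : γ ∈ dPaths Dubut) {a b : I} (hab : a ≤ b) :
    Relation.ReflTransGen (OrdStep γ) a b :=
  ordSteps_restrict ((isCellwiseMonotone_iff γ).1 h) a b bot_le hab le_top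

lemma monotone_comp_dPath {G : Dubut → ℝ} (hG : ∀ c, Monotone fun x => G (pt c x))
    {γ : C(I, Dubut)} (h : γ ∈ dPaths Dubut) : Monotone fun t => G (γ t) := by
  intro a b hab
  induction ordSteps_of_dPath h hab with
  | refl => exact le_rfl
  | @tail b c hb hbc ih =>
    obtain ⟨hbc, e, p, -, hm, he⟩ := hbc
    refine (ih (ordSteps_le hb)).trans ?_
    have hb' : b ∈ Set.Icc b c := ⟨le_rfl, hbc⟩
    have hc' : c ∈ Set.Icc b c := ⟨hbc, le_rfl⟩
    simpa only [he b hb', he c hc'] using hG e (hm hb' hc' hbc)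

lemma monotone_height {γ : C(I, Dubut)} (h : γ ∈ dPaths Dubut) :
    Monotone fun t => height (γ t) := by
  refine monotone_comp_dPath (fun c x y hxy => ?_) h
  have h1 : (x.1 : ℝ) ≤ y.1 := hxy.1
  have h2 : (x.2 : ℝ) ≤ y.2 := hxy.2
  cases c <;> simp <;> assumption

lemma monotone_coord₁ {γ : C(I, Dubut)} (h : γ ∈ dPaths Dubut) :
    Monotone fun t => coord₁ (γ t) := by
  refine monotone_comp_dPath (fun c x y hxy => ?_) h
  have h1 : (x.1 : ℝ) ≤ y.1 := hxy.1
  have h2 : (x.2 : ℝ) ≤ y.2 := hxy.2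
  cases c <;> simp only [coord₁_A, coord₁_B₁, coord₁_B₂, coord₁_C] <;> linarith

/-- A change of sign would force a zero of `side` in between, hence a point of height 0 or 1. The
height is monotone and lies strictly between 0 and 1 at both times, so this cannot occur. -/
lemma side_nonneg_of_pos {γ : C(I, Dubut)} (h : γ ∈ dPaths Dubut) {s : I} (hs : 0 < side (γ s))
    (t : I) : 0 ≤ side (γ t) := by
  by_contra! ht
  obtain ⟨r, hr, hr0⟩ : (0 : ℝ) ∈ (fun r => side (γ r)) '' Set.uIcc s t :=
    intermediate_value_uIcc (f := fun r => side (γ r)) (by fun_prop)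
      (Set.mem_uIcc.2 (.inr ⟨ht.le, hs.le⟩))
  have key : ∀ r, side (γ r) ≠ 0 → 0 < height (γ r) ∧ height (γ r) < 1 := by
    intro r hr
    rw [Ne, side_eq_zero_iff, not_or] at hr
    exact ⟨(height_nonneg _).lt_of_ne' hr.1, (height_le_one _).lt_of_ne hr.2⟩
  have h1 := key s hs.ne'
  have h2 := key t ht.ne
  have hm := monotone_height h
  have h3 : 0 < height (γ r) ∧ height (γ r) < 1 := by
    rcases Set.mem_uIcc.1 hr with hr | hr
    · exact ⟨h1.1.trans_le (hm hr.1), (hm hr.2).trans_lt h2.2⟩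
    · exact ⟨h2.1.trans_le (hm hr.1), (hm hr.2).trans_lt h1.2⟩
  rcases (side_eq_zero_iff _).1 hr0 with h4 | h4
  · exact h3.1.ne' h4
  · exact h3.2.ne h4

/-- The second coordinate in the row `A`, `B₁`, `C`. -/
def rowCoord (z : Dubut) : ℝ := coord₂ z - 2 * height z

@[fun_prop] lemma continuous_rowCoord : Continuous rowCoord := by
  unfold rowCoord
  fun_prop

@[simp] lemma rowCoord_A (x : I × I) : rowCoord (pt .A x) = x.2 := by simp [rowCoord]
@[simp] lemma rowCoord_B₁ (x : I × I) : rowCoord (pt .B₁ x) = x.2 := by simp [rowCoord]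
@[simp] lemma rowCoord_C (x : I × I) : rowCoord (pt .C x) = x.2 := by simp [rowCoord]

/-- The hypothesis on `side` is essential: inside `B₂` the function `rowCoord` is `1 - x.2`, which
decreases along d-paths. A path with non-negative `side` meets `B₂` only in its bottom and top
edges. -/
lemma monotone_rowCoord {γ : C(I, Dubut)} (h : γ ∈ dPaths Dubut) (h0 : ∀ t, 0 ≤ side (γ t)) :
    Monotone fun t => rowCoord (γ t) := by
  intro a b hab
  induction ordSteps_of_dPath h hab with
  | refl => exact le_rfl
  | @tail b c hb hbc ih =>
    obtain ⟨hbc, e, p, hp, hm, he⟩ := hbc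
    refine (ih (ordSteps_le hb)).trans ?_
    have hb' : b ∈ Set.Icc b c := ⟨le_rfl, hbc⟩
    have hc' : c ∈ Set.Icc b c := ⟨hbc, le_rfl⟩
    have h2 : (p b).2 ≤ (p c).2 := (hm hb' hc' hbc).2
    change rowCoord (γ b) ≤ rowCoord (γ c)
    rw [he b hb', he c hc']
    cases e
    · simpa using h2
    · simpa using h2
    · have key : ∀ s ∈ Set.Icc b c, ((p s).2 : ℝ) = 0 ∨ ((p s).2 : ℝ) = 1 := by
        intro s hs
        have h1 := h0 s
        rw [he s hs, side_B₂] at h1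
        have h2 := (p s).2.2
        rcases eq_or_ne ((p s).2 : ℝ) 0 with h3 | h3
        · exact .inl h3
        · have h4 : (0 : ℝ) < (p s).2 := h2.1.lt_of_ne' h3
          exact .inr (le_antisymm h2.2 (by nlinarith))
      -- By connectedness a step in `B₂` cannot jump from the bottom to the top edge: it would pass
      -- through the value 1/2.
      have h3 : ((p c).2 : ℝ) ≤ (p b).2 := by
        by_contra! h3
        have hpb : ((p b).2 : ℝ) = 0 := by
          rcases key b hb' with h | h
          · exact h
          · linarith [(p c).2.2.2]
        have hpc : ((p c).2 : ℝ) = 1 := by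
          rcases key c hc' with h | h
          · linarith [(p b).2.2.1]
          · exact h
        obtain ⟨r, hr, hr'⟩ : (1 / 2 : ℝ) ∈ (fun s => ((p s).2 : ℝ)) '' Set.Icc b c :=
          intermediate_value_Icc hbc (by fun_prop) ⟨by simp [hpb], by simp only [hpc]; norm_num⟩
        rcases key r hr with h | h <;> simp only [h] at hr' <;> norm_num at hr'
      simp only [rowCoord, coord₂_B₂, height_B₂]
      linarith
    · simpa using h2

/-! ## The row `A`, `B₁`, `C` -/

lemma continuous_ptB₁C : Continuous fun x : ℝ × I => ptB₁C x.1 x.2 := by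
  unfold ptB₁C
  refine Continuous.if_le ((continuous_pt _).comp ?_) ((continuous_pt _).comp ?_) continuous_fst
    continuous_const ?_
  · exact (continuous_projIcc.comp continuous_fst).prodMk continuous_snd
  · exact (continuous_projIcc.comp (by fun_prop)).prodMk continuous_snd
  · rintro ⟨u, v⟩ (rfl : u = 1)
    simpa [Set.projIcc_of_le_left] using glue_B₁C v

/-- The row `A`, `B₁`, `C` as the image of the rectangle `[0, 3] × [0, 1]`. -/
noncomputable def row (x : ℝ × ℝ) : Dubut :=
  if x.1 ≤ 1 then pt .A (Set.projIcc 0 1 zero_le_one x.1, Set.projIcc 0 1 zero_le_one x.2)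
  else ptB₁C (x.1 - 1) (Set.projIcc 0 1 zero_le_one x.2)

lemma row_of_le_one {x : ℝ × ℝ} (h : x.1 ≤ 1) :
    row x = pt .A (Set.projIcc 0 1 zero_le_one x.1, Set.projIcc 0 1 zero_le_one x.2) := if_pos h

lemma row_of_one_le {x : ℝ × ℝ} (h : 1 ≤ x.1) :
    row x = ptB₁C (x.1 - 1) (Set.projIcc 0 1 zero_le_one x.2) := by
  rcases h.eq_or_lt with h | h
  · rw [row_of_le_one h.ge, ptB₁C, if_pos (by linarith), ← h]
    simpa using glue_AB₁ _
  · exact if_neg h.not_ge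

lemma row_of_mem_Icc {x : ℝ × ℝ} (h : 1 ≤ x.1) (h' : x.1 ≤ 2) :
    row x = pt .B₁ (Set.projIcc 0 1 zero_le_one (x.1 - 1), Set.projIcc 0 1 zero_le_one x.2) := by
  rw [row_of_one_le h, ptB₁C, if_pos (by linarith)]

lemma row_of_two_le {x : ℝ × ℝ} (h : 2 ≤ x.1) :
    row x = pt .C (Set.projIcc 0 1 zero_le_one (x.1 - 2), Set.projIcc 0 1 zero_le_one x.2) := by
  rcases h.eq_or_lt with h | h
  · rw [row_of_mem_Icc (by linarith) h.ge, ← h]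
    have h1 : Set.projIcc (0 : ℝ) 1 zero_le_one (2 - 1) = 1 := by norm_num
    have h2 : Set.projIcc (0 : ℝ) 1 zero_le_one (2 - 2) = 0 := by norm_num
    rw [h1, h2, glue_B₁C]
  · rw [row_of_one_le (by linarith), ptB₁C, if_neg (by linarith), sub_sub]
    norm_num

@[fun_prop] lemma continuous_row : Continuous row := by
  unfold row
  refine Continuous.if_le ((continuous_pt _).comp ?_)
    (continuous_ptB₁C.comp (f := fun x : ℝ × ℝ => (x.1 - 1, Set.projIcc 0 1 zero_le_one x.2)) ?_)
    continuous_fst continuous_const ?_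
  · exact (continuous_projIcc.comp continuous_fst).prodMk (continuous_projIcc.comp continuous_snd)
  · exact (by fun_prop : Continuous fun x : ℝ × ℝ => x.1 - 1).prodMk
      (continuous_projIcc.comp continuous_snd)
  · rintro x hx
    rw [← row_of_le_one hx.le, row_of_one_le hx.ge]

/-- The pair `(coord₁, rowCoord)` serves as planar coordinates on the row, which allows convex
combinations of paths there. -/
lemma row_coord {z : Dubut} (h : 0 ≤ side z) : row (coord₁ z, rowCoord z) = z := by
  rcases cases_of_side_nonneg h with ⟨⟨u, v⟩, rfl⟩ | ⟨⟨u, v⟩, rfl⟩ | ⟨⟨u, v⟩, rfl⟩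
  · rw [row_of_le_one (by simpa using u.2.2)]
    simp
  · rw [row_of_mem_Icc (by simpa using u.2.1) (by simp; linarith [u.2.2])]
    simp
  · rw [row_of_two_le (by simpa using u.2.1)]
    simp

lemma side_row (x : ℝ × ℝ) : 0 ≤ side (row x) := by
  rcases le_total x.1 1 with h | h
  · rw [row_of_le_one h, side_A]
  · rcases le_total x.1 2 with h' | h'
    · rw [row_of_mem_Icc h h', side_B₁]
      exact mul_nonneg (unitInterval.nonneg _) (unitInterval.one_minus_nonneg _)
    · rw [row_of_two_le h', side_C]

/-- The first coordinate is monotone, so cutting at times where it equals 1 and 2 leaves at most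
three pieces, one in each of `A`, `B₁` and `C`. -/
lemma row_dPath {α : I → ℝ × ℝ} (hα : Continuous α) (hm : Monotone α) :
    (⟨fun t => row (α t), by fun_prop⟩ : C(I, Dubut)) ∈ dPaths Dubut := by
  have hm1 : ∀ {s t}, s ≤ t → (α s).1 ≤ (α t).1 := fun h => (hm h).1
  have hproj : Monotone (Set.projIcc (0 : ℝ) 1 zero_le_one) := Set.monotone_projIcc _
  have cs : ∀ (c : Cell) (k : ℝ) (a b : I), (∀ s ∈ Set.Icc a b, row (α s) =
      pt c (Set.projIcc 0 1 zero_le_one ((α s).1 - k), Set.projIcc 0 1 zero_le_one (α s).2)) →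
      CellStep ⟨fun t => row (α t), by fun_prop⟩ a b := by
    intro c k a b h
    refine ⟨c, fun s => (Set.projIcc 0 1 zero_le_one ((α s).1 - k),
      Set.projIcc 0 1 zero_le_one (α s).2), Continuous.continuousOn ?_, fun s _ t _ hst => ?_, h⟩
    · exact (continuous_projIcc.comp (by fun_prop)).prodMk (continuous_projIcc.comp (by fun_prop))
    · exact ⟨hproj (sub_le_sub_right (hm hst).1 k), hproj (hm hst).2⟩
  have ivt : ∀ {a b : I} {r : ℝ}, a ≤ b → (α a).1 ≤ r → r ≤ (α b).1 →
      ∃ c, a ≤ c ∧ c ≤ b ∧ (α c).1 = r := by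
    intro a b r hab h1 h2
    obtain ⟨c, hc, h⟩ := intermediate_value_Icc hab (f := fun t => (α t).1) (by fun_prop) ⟨h1, h2⟩
    exact ⟨c, hc.1, hc.2, h⟩
  have sC : ∀ a b, a ≤ b → 2 ≤ (α a).1 →
      Relation.ReflTransGen (OrdStep ⟨fun t => row (α t), by fun_prop⟩) a b := fun a b hab h =>
    .single ⟨hab, cs .C 2 a b fun s hs => row_of_two_le (h.trans (hm1 hs.1))⟩
  have sB : ∀ a b, a ≤ b → 1 ≤ (α a).1 →
      Relation.ReflTransGen (OrdStep ⟨fun t => row (α t), by fun_prop⟩) a b := by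
    intro a b hab h
    have step : ∀ b, a ≤ b → (α b).1 ≤ 2 → OrdStep ⟨fun t => row (α t), by fun_prop⟩ a b :=
      fun b hab hb => ⟨hab, cs .B₁ 1 a b fun s hs =>
        row_of_mem_Icc (h.trans (hm1 hs.1)) ((hm1 hs.2).trans hb)⟩
    rcases le_total (α b).1 2 with hb | hb
    · exact .single (step b hab hb)
    · rcases le_total 2 (α a).1 with ha | ha
      · exact sC a b hab ha
      · obtain ⟨c, h1, h2, h3⟩ := ivt hab ha hb
        exact .head (step c h1 h3.le) (sC c b h2 h3.ge)
  refine (isCellwiseMonotone_iff _).2 ?_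
  have step : ∀ b, (α b).1 ≤ 1 → OrdStep ⟨fun t => row (α t), by fun_prop⟩ 0 b :=
    fun b hb => ⟨bot_le, cs .A 0 0 b fun s hs => by
      rw [row_of_le_one ((hm1 hs.2).trans hb), sub_zero]⟩
  rcases le_total (α 1).1 1 with hb | hb
  · exact .single (step 1 hb)
  · rcases le_total 1 (α 0).1 with ha | ha
    · exact sB 0 1 zero_le_one ha
    · obtain ⟨c, h1, h2, h3⟩ := ivt zero_le_one ha hb
      exact .head (step c h3.le) (sB c 1 h2 h3.ge)

end Dubut

/-! ## Path components of trace spaces -/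

section
variable {X : Type*} [TopologicalSpace X] [DSpace X]

/-- There is a directed path from `x` to `y`. -/
def Reach (x y : X) : Prop := Nonempty (DPath x y)

/-- The trace space from `x` to `y` has at most one path component. -/
def TraceConnected (x y : X) : Prop := Subsingleton (ZerothHomotopy (Trace x y))

lemma traceConnected_iff {x y : X} : TraceConnected x y ↔
    ∀ p q : DPath x y, Joined (Quot.mk _ p : Trace x y) (Quot.mk _ q) := by
  constructor
  · intro h p q
    exact Quotient.exact (h.elim (ZerothHomotopy.mk (Quot.mk _ p)) (ZerothHomotopy.mk (Quot.mk _ q)))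
  · intro h
    refine ⟨fun a b => ?_⟩
    induction a using Quotient.inductionOn with | _ a
    induction b using Quotient.inductionOn with | _ b
    obtain ⟨p, rfl⟩ := Quot.exists_rep a
    obtain ⟨q, rfl⟩ := Quot.exists_rep b
    exact Quotient.sound (h p q)

lemma Reach.map {x y : X} (h : Reach x y) (f : DMap X X) : Reach (f x) (f y) :=
  Nonempty.map (f.pathMap x y) h

lemma TraceConnected.map {x y : X} (h : TraceConnected x y) (f : DMap X X)
    (hf : Function.Surjective (f.pathMap x y)) : TraceConnected (f x) (f y) := by
  refine traceConnected_iff.2 fun p q => ?_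
  obtain ⟨p, rfl⟩ := hf p
  obtain ⟨q, rfl⟩ := hf q
  exact (traceConnected_iff.1 h p q).map (f.traceMap x y).continuous

/-- The only information about `F` that the argument uses: a bijection on path components preserves
and reflects having at most one component. -/
lemma IsPsp.traceConnected_iff {X : Type} [TopologicalSpace X] [DSpace X]
    {F : MorphismProperty TopCat.{0}} (hF : F ≤ pi0Bijective)
    {f : DMap X X} (hf : IsPsp F f) {x y : X} (h : Reach x y) :
    TraceConnected (f x) (f y) ↔ TraceConnected x y :=
  (Equiv.ofBijective _ (hF _ (hf x y h))).subsingleton_congr.symm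

end

namespace Dubut

/-! ## Reachability in the complex -/

/-- A directed path in the row `A`, `B₁`, `C`. -/
noncomputable def rowPath {x y : ℝ × ℝ} (h : x ≤ y) : DPath (row x) (row y) :=
  ⟨⟨fun t : I => row (x + (t : ℝ) • (y - x)), by fun_prop⟩,
    row_dPath (by fun_prop) (fun s t hst => by
      have h1 : (0 : ℝ × ℝ) ≤ y - x := sub_nonneg.2 h
      have h2 : (s : ℝ) ≤ t := hst
      gcongr), by simp, by simp⟩

lemma reach_row {x y : ℝ × ℝ} (h : x ≤ y) : Reach (row x) (row y) := ⟨rowPath h⟩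

lemma row_A (x : I × I) : row (x.1, x.2) = pt .A x := by
  simpa using row_coord (z := pt .A x) (by simp)

lemma side_B₁_nonneg (x : I × I) : 0 ≤ side (pt .B₁ x) :=
  mul_nonneg x.1.2.1 (unitInterval.one_minus_nonneg x.1)

lemma row_B₁ (x : I × I) : row (1 + x.1, x.2) = pt .B₁ x := by
  simpa using row_coord (side_B₁_nonneg x)

lemma row_C (x : I × I) : row (2 + x.1, x.2) = pt .C x := by
  simpa using row_coord (z := pt .C x) (by simp)

lemma _root_.DirectedTop.Reach.swap {x y : Dubut} (h : Reach x y) : Reach (swap x) (swap y) :=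
  h.map swapDMap

lemma reach_A_A {x y : I × I} (h : x ≤ y) : Reach (pt .A x) (pt .A y) := by
  rw [← row_A, ← row_A]
  exact reach_row h

lemma reach_B₁_B₁ {x y : I × I} (h : x ≤ y) : Reach (pt .B₁ x) (pt .B₁ y) := by
  rw [← row_B₁, ← row_B₁]
  exact reach_row ⟨by simpa using h.1, h.2⟩

lemma reach_B₁_C {x y : I × I} (h : x.2 ≤ y.2) : Reach (pt .B₁ x) (pt .C y) := by
  rw [← row_B₁, ← row_C]
  exact reach_row ⟨by dsimp only; linarith [x.1.2.2, y.1.2.1], h⟩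

lemma reach_A_C {x y : I × I} (h : x.2 ≤ y.2) : Reach (pt .A x) (pt .C y) := by
  rw [← row_A, ← row_C]
  exact reach_row ⟨by dsimp only; linarith [x.1.2.2, y.1.2.1], h⟩

lemma reach_C_C {x y : I × I} (h : x ≤ y) : Reach (pt .C x) (pt .C y) := by
  rw [← row_C, ← row_C]
  exact reach_row ⟨by simpa using h.1, h.2⟩

lemma reach_cPlus (z : Dubut) : Reach z cPlus := by
  obtain ⟨c, x, rfl⟩ := exists_pt z
  cases c
  · exact reach_A_C unitInterval.le_one'
  · exact reach_B₁_C unitInterval.le_one'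
  · exact (reach_B₁_C (x := x.swap) (y := (1, 1)) unitInterval.le_one').swap
  · exact reach_C_C ⟨unitInterval.le_one', unitInterval.le_one'⟩

section
variable {x y : Dubut}

lemma height_le (h : Reach x y) : height x ≤ height y := by
  obtain ⟨p, hp, rfl, rfl⟩ := h
  exact monotone_height hp zero_le_one

lemma coord₁_le (h : Reach x y) : coord₁ x ≤ coord₁ y := by
  obtain ⟨p, hp, rfl, rfl⟩ := h
  exact monotone_coord₁ hp zero_le_one

lemma coord₂_le (h : Reach x y) : coord₂ x ≤ coord₂ y := by
  simpa using coord₁_le h.swap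

/-- Outside `A` the choice between the two routes has been made. If `side x = 0`, then `x` lies in
`C`, where monotonicity of the height keeps the path. -/
lemma side_nonneg_of_height_pos (h : 0 < height x) (h' : 0 ≤ side x) (p : DPath x y) (t : I) :
    0 ≤ side (p.1 t) := by
  obtain ⟨p, hp, rfl, rfl⟩ := p
  rcases h'.eq_or_lt with h' | h'
  · have h0 : height (p 0) = 1 := ((side_eq_zero_iff _).1 h'.symm).resolve_left h.ne'
    exact ((side_eq_zero_iff _).2 (.inr (le_antisymm (height_le_one _)
      (h0.symm.trans_le (monotone_height hp bot_le))))).ge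
  · exact side_nonneg_of_pos hp h' t

lemma rowCoord_le (h : 0 < height x) (h' : 0 ≤ side x) (hxy : Reach x y) :
    0 ≤ side y ∧ rowCoord x ≤ rowCoord y := by
  obtain ⟨p⟩ := hxy
  have := side_nonneg_of_height_pos h h' p
  obtain ⟨p, hp, rfl, rfl⟩ := p
  exact ⟨this 1, monotone_rowCoord hp this zero_le_one⟩

/-- Directed paths in the row `A`, `B₁`, `C` with common end points are connected by a straight
line homotopy. -/
lemma joined_of_side_nonneg (p q : DPath x y) (hp : ∀ t, 0 ≤ side (p.1 t))
    (hq : ∀ t, 0 ≤ side (q.1 t)) : Joined p q := by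
  obtain ⟨p, hp1, hp2, hp3⟩ := p
  obtain ⟨q, hq1, hq2, hq3⟩ := q
  let P : I → ℝ × ℝ := fun t => (coord₁ (p t), rowCoord (p t))
  let Q : I → ℝ × ℝ := fun t => (coord₁ (q t), rowCoord (q t))
  have hPc : Continuous P := by fun_prop
  have hQc : Continuous Q := by fun_prop
  have hP : Monotone P := fun s t h => ⟨monotone_coord₁ hp1 h, monotone_rowCoord hp1 hp h⟩
  have hQ : Monotone Q := fun s t h => ⟨monotone_coord₁ hq1 h, monotone_rowCoord hq1 hq h⟩
  have hPr : ∀ t, row (P t) = p t := fun t => row_coord (hp t)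
  have hQr : ∀ t, row (Q t) = q t := fun t => row_coord (hq t)
  have h0 : P 0 = Q 0 := by simp only [P, Q, hp2, hq2]
  have h1 : P 1 = Q 1 := by simp only [P, Q, hp3, hq3]
  let γ : I → DPath x y := fun s =>
    ⟨⟨fun t => row ((1 - s : ℝ) • P t + (s : ℝ) • Q t), by fun_prop⟩,
      row_dPath (by fun_prop) (fun a b hab => add_le_add
        (smul_le_smul_of_nonneg_left (hP hab) (unitInterval.one_minus_nonneg s))
        (smul_le_smul_of_nonneg_left (hQ hab) s.2.1)),
      by simp [h0, ← add_smul, hQr, hq2], by simp [h1, ← add_smul, hQr, hq3]⟩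
  refine ⟨⟨⟨γ, ?_⟩, ?_, ?_⟩⟩
  · refine Continuous.subtype_mk (ContinuousMap.continuous_of_continuous_uncurry _ ?_) _
    change Continuous fun z : I × I => row ((1 - z.1 : ℝ) • P z.2 + (z.1 : ℝ) • Q z.2)
    fun_prop
  · exact Subtype.ext (ContinuousMap.ext fun t => by simp [γ, hPr])
  · exact Subtype.ext (ContinuousMap.ext fun t => by simp [γ, hQr])

/-! ## Components of the trace spaces of the complex -/

lemma traceConnected_of_side_nonneg (h : ∀ (p : DPath x y) t, 0 ≤ side (p.1 t)) :
    TraceConnected x y :=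
  traceConnected_iff.2 fun p q =>
    (joined_of_side_nonneg p q (h p) (h q)).map continuous_quot_mk

lemma _root_.DirectedTop.TraceConnected.swap (h : TraceConnected x y) :
    TraceConnected (swap x) (swap y) := by
  refine h.map swapDMap fun q => ?_
  refine ⟨⟨swapDMap.toMap.comp q.1, swapDMap.map_dPaths _ q.2.1, ?_, ?_⟩, ?_⟩
  · exact (congrArg Dubut.swap q.2.2.1).trans (swap_swap x)
  · exact (congrArg Dubut.swap q.2.2.2).trans (swap_swap y)
  · exact Subtype.ext (ContinuousMap.ext fun t => swap_swap _)

lemma traceConnected_of_height_pos (h : 0 < height x) : TraceConnected x y := by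
  rcases le_total 0 (side x) with h' | h'
  · exact traceConnected_of_side_nonneg (side_nonneg_of_height_pos h h')
  · have := (traceConnected_of_side_nonneg (x := swap x) (y := swap y)
      (side_nonneg_of_height_pos (by simpa using h) (by simpa using h'))).swap
    simpa using this

/-- A path that enters the interior of `B₂` stays in the column `A`, `B₂`, `C`, where the first
coordinate is non-decreasing; this contradicts `y.1 < x.1`. -/
lemma side_nonneg_of_lt {x y : I × I} (h : y.1 < x.1) (p : DPath (pt .A x) (pt .C y)) (t : I) :
    0 ≤ side (p.1 t) := by
  obtain ⟨p, hp, hp0, hp1⟩ := p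
  by_contra! ht
  have hp' := swapDMap.map_dPaths p hp
  have key : ∀ s, 0 ≤ side (swapDMap.toMap.comp p s) :=
    side_nonneg_of_pos hp' (s := t) (by
      change 0 < side (swap (p t))
      simpa using ht)
  have h1 : rowCoord (swap (p 0)) ≤ rowCoord (swap (p 1)) := monotone_rowCoord hp' key zero_le_one
  rw [hp0, hp1] at h1
  have h2 : (y.1 : ℝ) < x.1 := h
  simp at h1
  exact absurd h (not_lt.2 h1)

lemma traceConnected_of_lt {x y : I × I} (h : y.1 < x.1) :
    TraceConnected (pt .A x) (pt .C y) :=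
  traceConnected_of_side_nonneg (side_nonneg_of_lt h)

/-- Both routes are available, and the sign taken by `side` tells them apart. The two conditions are
open, complementary and invariant under reparametrization, so they split the trace space into two
non-empty clopen sets. -/
lemma not_traceConnected {x y : I × I} (h : x ≤ y) : ¬ TraceConnected (pt .A x) (pt .C y) := by
  intro hc
  obtain ⟨p, hp⟩ : ∃ p : DPath (pt .A x) (pt .C y), ∀ t, 0 ≤ side (p.1 t) := by
    rw [← row_A, ← row_C]
    exact ⟨rowPath ⟨by dsimp only; linarith [x.1.2.2, y.1.2.1], h.2⟩, fun t => side_row _⟩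
  obtain ⟨q, hq⟩ : ∃ q : DPath (pt .A x) (pt .C y), ∀ t, side (q.1 t) ≤ 0 := by
    obtain ⟨q, hq⟩ : ∃ q : DPath (pt .A x.swap) (pt .C y.swap), ∀ t, 0 ≤ side (q.1 t) := by
      rw [← row_A, ← row_C]
      exact ⟨rowPath ⟨by simp only [Prod.fst_swap]; linarith [x.2.2.2, y.2.2.1], h.1⟩, fun t => side_row _⟩
    refine ⟨swapDMap.pathMap _ _ q, fun t => ?_⟩
    change side (swap (q.1 t)) ≤ 0
    simpa using hq t
  obtain ⟨γ⟩ := traceConnected_iff.1 hc p q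
  let up (p : DPath (pt .A x) (pt .C y)) : Prop := ∃ t, 0 < side (p.1 t)
  let down (p : DPath (pt .A x) (pt .C y)) : Prop := ∃ t, side (p.1 t) < 0
  have up_or_down : ∀ p, up p ∨ down p := by
    intro p
    -- Any height strictly between 0 and 1 would do: there `side` does not vanish, so the path takes
    -- one of the two routes.
    obtain ⟨t, -, ht⟩ : (1 / 2 : ℝ) ∈ (fun t => height (p.1 t)) '' Set.Icc 0 1 :=
      intermediate_value_Icc (f := fun t => height (p.1 t)) zero_le_one (by fun_prop)
        (by simp only [p.2.2.1, p.2.2.2]; norm_num)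
    have hs : side (p.1 t) ≠ 0 := by
      rw [Ne, side_eq_zero_iff]
      simp only at ht
      rw [ht]
      norm_num
    exact hs.lt_or_gt.symm.imp (fun h => ⟨t, h⟩) fun h => ⟨t, h⟩
  have not_both : ∀ p, down p ↔ ¬ up p := fun p =>
    ⟨fun ⟨t, ht⟩ ⟨s, hs⟩ => (side_nonneg_of_pos p.2.1 hs t).not_gt ht, (up_or_down p).resolve_left⟩
  have open_up : IsOpen {p | up p} := by
    have : {p | up p} = ⋃ t, {p : DPath (pt .A x) (pt .C y) | 0 < side (p.1 t)} := by
      ext; simp [up]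
    rw [this]
    exact isOpen_iUnion fun t => isOpen_lt continuous_const (continuous_side.comp
      ((continuous_eval_const t).comp continuous_subtype_val))
  have open_down : IsOpen {p | down p} := by
    have : {p | down p} = ⋃ t, {p : DPath (pt .A x) (pt .C y) | side (p.1 t) < 0} := by
      ext; simp [down]
    rw [this]
    exact isOpen_iUnion fun t => isOpen_lt (continuous_side.comp
      ((continuous_eval_const t).comp continuous_subtype_val)) continuous_const
  -- The condition `up` descends to traces because a surjective reparametrization visits the same
  -- points.
  let S : Set (Trace (pt .A x) (pt .C y)) := {τ | Quot.lift up (by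
    rintro p q ⟨φ, -, hφ, e⟩
    simp only [up, e, ContinuousMap.comp_apply]
    exact propext (hφ.exists (p := fun t => 0 < side (p.1 t))).symm.symm) τ}
  have hS : IsClopen S := by
    refine ⟨⟨?_⟩, isQuotientMap_quot_mk.isOpen_preimage.1 open_up⟩
    refine isQuotientMap_quot_mk.isOpen_preimage.1 ?_
    have : Quot.mk _ ⁻¹' Sᶜ = {p | down p} := by
      ext p
      exact (not_both p).symm
    rwa [this]
  have h0 : (0 : I) ∈ γ ⁻¹' S := by
    rw [Set.mem_preimage, γ.source]
    exact (up_or_down p).resolve_right fun ⟨t, ht⟩ => (hp t).not_gt ht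
  have h1 : (1 : I) ∈ γ ⁻¹' S := by
    rw [(hS.preimage γ.continuous).eq_univ ⟨0, h0⟩]
    trivial
  rw [Set.mem_preimage, γ.target] at h1
  obtain ⟨t, ht⟩ : up q := h1
  exact (hq t).not_gt ht

end

end Dubut

namespace Dubut

/-! ## Inessential maps of the complex -/

/-- The properties of future inessential maps from which their form is determined: they are
increasing and respect reachability and the connectedness of trace spaces. -/
structure Inessential (f : Dubut → Dubut) : Prop where
  continuous : Continuous f
  reach : ∀ x, Reach x (f x)
  map_reach : ∀ {x y}, Reach x y → Reach (f x) (f y)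
  traceConnected_iff : ∀ {x y}, Reach x y → (TraceConnected (f x) (f y) ↔ TraceConnected x y)

lemma _root_.DirectedTop.IsFutureInessential.inessential {F : MorphismProperty TopCat.{0}}
    (hF : F ≤ pi0Bijective) {f : DMap Dubut Dubut} (hf : IsFutureInessential F f) :
    Inessential f := by
  obtain ⟨H, h0, h1, hpsp⟩ := hf
  refine ⟨f.toMap.continuous, fun x => ?_, fun h => h.map f, fun {x y} h => ?_⟩
  · refine ⟨⟨H.toMap.comp ((ContinuousMap.const I x).prodMk (ContinuousMap.id I)),
      H.map_dPaths _ ⟨DSpace.const_mem x, fun _ _ h => h⟩, h0 x, h1 x⟩⟩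
  -- The final level suffices here; the rest of the flow enters only through the d-path that it
  -- traces from `x` to `f x`.
  · have := (hpsp 1).traceConnected_iff hF h
    have e : ∀ x, H.level 1 x = f x := h1
    rwa [e, e] at this

namespace Inessential

variable {f : Dubut → Dubut} (hf : Inessential f)
include hf

lemma swap_conj : Inessential (swap ∘ f ∘ swap) where
  continuous := by have := hf.continuous; fun_prop
  reach x := by simpa using (hf.reach (Dubut.swap x)).swap
  map_reach h := (hf.map_reach h.swap).swap
  traceConnected_iff {x y} h := by
    have key : ∀ {x y}, TraceConnected (Dubut.swap x) (Dubut.swap y) ↔ TraceConnected x y :=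
      fun {x y} => ⟨fun h => by simpa using h.swap, fun h => h.swap⟩
    simp only [Function.comp_apply, key]
    rw [hf.traceConnected_iff h.swap, key]

/-! ### The vertex `cPlus` and the images of the cells -/

lemma map_cPlus : f cPlus = cPlus := by
  have h1 := coord₁_le (hf.reach cPlus)
  have h2 := coord₂_le (hf.reach cPlus)
  have h3 := height_le (hf.reach cPlus)
  obtain ⟨⟨u, v⟩, hx⟩ := height_eq_one_iff.1 (le_antisymm (height_le_one (f cPlus)) h3)
  rw [hx] at h1 h2 ⊢
  simp only [cPlus, coord₁_C, coord₂_C] at h1 h2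
  have hu : u = 1 := le_antisymm unitInterval.le_one' (Subtype.coe_le_coe.1 (by linarith))
  have hv : v = 1 := le_antisymm unitInterval.le_one' (Subtype.coe_le_coe.1 (by linarith))
  rw [hu, hv, cPlus]

/-- The points of `A` are recognized intrinsically: they are those with a disconnected trace space
to `cPlus`, which `f` fixes. -/
lemma height_eq_zero_iff {z : Dubut} : height (f z) = 0 ↔ height z = 0 := by
  have key : ∀ z, TraceConnected z cPlus ↔ height z ≠ 0 := by
    intro z
    refine ⟨fun h hz => ?_, fun h => traceConnected_of_height_pos ((height_nonneg z).lt_of_ne' h)⟩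
    obtain ⟨x, rfl⟩ := Dubut.height_eq_zero_iff.1 hz
    exact not_traceConnected (y := (1, 1)) ⟨unitInterval.le_one', unitInterval.le_one'⟩ h
  have := hf.traceConnected_iff (reach_cPlus z)
  rw [hf.map_cPlus, key, key] at this
  exact not_iff_not.1 this

lemma map_A (x : I × I) : ∃ y, f (pt .A x) = pt .A y :=
  Dubut.height_eq_zero_iff.1 (hf.height_eq_zero_iff.2 rfl)

lemma map_C (x : I × I) : ∃ y, f (pt .C x) = pt .C y :=
  height_eq_one_iff.1 (le_antisymm (height_le_one _) (height_le (hf.reach (pt .C x))))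

lemma map_B₁ {x : I × I} (hx : 0 < x.1) : 0 < height (f (pt .B₁ x)) ∧ 0 ≤ side (f (pt .B₁ x)) := by
  have h : 0 < height (pt .B₁ x) := hx
  refine ⟨(height_nonneg _).lt_of_ne' fun h0 => h.ne' (hf.height_eq_zero_iff.1 h0), ?_⟩
  exact (rowCoord_le h (side_B₁_nonneg x) (hf.reach _)).1

/-! ### Comparison of coordinates on `A` and `C` -/

/-- Reachability from a point of `A` does not control `rowCoord`, since the path might run through
`B₂`. Hence the edge is approached from inside `B₁`, where `f` takes values of positive height, and
continuity gives the limit. -/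
lemma rowCoord_A_le_B₁ {s t : I} (hs : 0 < s) :
    rowCoord (f (pt .A (1, t))) ≤ rowCoord (f (pt .B₁ (s, t))) := by
  have hc := hf.continuous
  have hlim : Filter.Tendsto (fun r : I => rowCoord (f (pt .B₁ (r, t)))) (nhdsWithin 0 (Set.Ioi 0))
      (nhds (rowCoord (f (pt .A (1, t))))) := by
    rw [glue_AB₁]
    refine Filter.Tendsto.mono_left ?_ nhdsWithin_le_nhds
    refine Continuous.tendsto (f := fun r : I => rowCoord (f (pt .B₁ (r, t)))) ?_ 0
    exact continuous_rowCoord.comp (hc.comp ((continuous_pt _).comp (by fun_prop)))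
  have : (nhdsWithin (0 : I) (Set.Ioi 0)).NeBot := nhdsGT_neBot_of_exists_gt ⟨s, hs⟩
  refine le_of_tendsto hlim ?_
  filter_upwards [Ioo_mem_nhdsGT hs] with r hr
  obtain ⟨h1, h2⟩ := hf.map_B₁ (x := (r, t)) hr.1
  exact (rowCoord_le h1 h2 (hf.map_reach (reach_B₁_B₁ (Prod.mk_le_mk.2 ⟨hr.2.le, le_rfl⟩)))).2

/-- Three comparisons are chained: rightwards in `A` to its right edge, across `B₁`, and from there
to `[C;y]`. -/
lemma rowCoord_A_le_C {x y : I × I} (h : x.2 ≤ y.2) :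
    rowCoord (f (pt .A x)) ≤ rowCoord (f (pt .C y)) := by
  have h0 := coord₂_le (hf.map_reach (reach_A_A (x := x) (y := (1, x.2))
    ⟨unitInterval.le_one', le_rfl⟩))
  have h1 := hf.rowCoord_A_le_B₁ (s := 1) (t := x.2) one_pos
  obtain ⟨h2, h3⟩ := hf.map_B₁ (x := (1, x.2)) one_pos
  have h4 := (rowCoord_le h2 h3 (hf.map_reach (reach_B₁_C (y := y) h))).2
  refine le_trans ?_ (h1.trans h4)
  simpa only [rowCoord, hf.height_eq_zero_iff.2 (height_A _), mul_zero, sub_zero] using h0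

lemma coord₂_A_le_C {x y : I × I} (h : x.2 ≤ y.2) :
    2 + coord₂ (f (pt .A x)) ≤ coord₂ (f (pt .C y)) := by
  have := hf.rowCoord_A_le_C h
  obtain ⟨a, ha⟩ := hf.map_A x
  obtain ⟨b, hb⟩ := hf.map_C y
  rw [ha, hb] at this ⊢
  simpa using this

lemma coord₁_A_le_C {x y : I × I} (h : x.1 ≤ y.1) :
    2 + coord₁ (f (pt .A x)) ≤ coord₁ (f (pt .C y)) := by
  simpa using hf.swap_conj.coord₂_A_le_C (x := x.swap) (y := y.swap) h

/-- The trace space from `[A;x]` to `[C;y]` is connected, hence so is that between the images. Their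
second coordinates are already ordered, so ordered first coordinates would make it disconnected. -/
lemma coord₁_C_lt_A {x y : I × I} (h1 : y.1 < x.1) (h2 : x.2 ≤ y.2) :
    coord₁ (f (pt .C y)) < 2 + coord₁ (f (pt .A x)) := by
  by_contra! h
  have h3 := (hf.traceConnected_iff (reach_A_C h2)).2 (traceConnected_of_lt h1)
  have h4 := hf.coord₂_A_le_C h2
  obtain ⟨a, ha⟩ := hf.map_A x
  obtain ⟨b, hb⟩ := hf.map_C y
  rw [ha, hb] at h h3 h4
  simp only [coord₁_A, coord₁_C, coord₂_A, coord₂_C, add_le_add_iff_left] at h h4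
  exact not_traceConnected ⟨h, h4⟩ h3

/-- One inequality is `coord₁_A_le_C`; the other is the limit of the strict inequality
`coord₁_C_lt_A` as the first coordinate in `A` decreases to `u`. -/
lemma coord₁_C_eq_A (u : I) {v w : I} (h : v ≤ w) :
    coord₁ (f (pt .C (u, w))) = 2 + coord₁ (f (pt .A (u, v))) := by
  refine le_antisymm ?_ (hf.coord₁_A_le_C le_rfl)
  -- At `u = 1` there is nothing to the right to take a limit from. There `f` cannot lower the
  -- coordinate 1 on `A`, so the right-hand side is at least 3, the maximum of `coord₁`.
  rcases (unitInterval.le_one' (t := u)).eq_or_lt with rfl | hu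
  · obtain ⟨b, hb⟩ := hf.map_C (1, w)
    have h1 := coord₁_le (hf.reach (pt .A (1, v)))
    rw [hb, coord₁_C]
    simp only [coord₁_A] at h1
    have := b.1.2.2
    simp only [Set.Icc.coe_one] at h1
    linarith
  · have hc := hf.continuous
    have hlim : Filter.Tendsto (fun r : I => 2 + coord₁ (f (pt .A (r, v))))
        (nhdsWithin u (Set.Ioi u)) (nhds (2 + coord₁ (f (pt .A (u, v))))) := by
      refine Filter.Tendsto.mono_left ?_ nhdsWithin_le_nhds
      refine Continuous.tendsto (f := fun r : I => 2 + coord₁ (f (pt .A (r, v)))) ?_ u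
      exact continuous_const.add
        (continuous_coord₁.comp (hc.comp ((continuous_pt _).comp (by fun_prop))))
    have : (nhdsWithin u (Set.Ioi u)).NeBot := nhdsGT_neBot_of_exists_gt ⟨1, hu⟩
    refine ge_of_tendsto hlim ?_
    filter_upwards [self_mem_nhdsWithin] with r hr
    exact (hf.coord₁_C_lt_A (x := (r, v)) (y := (u, w)) hr h).le

/-- The first coordinate of `f` on `A` and `C` is a function of the first coordinate. -/
lemma exists_coord₁ : ∃ g : I → I, Continuous g ∧ StrictMono g ∧ (∀ t, t ≤ g t) ∧
    (∀ x, coord₁ (f (pt .A x)) = g x.1) ∧ ∀ x, coord₁ (f (pt .C x)) = 2 + g x.1 := by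
  have hc := hf.continuous
  have hmem : ∀ t : I, coord₁ (f (pt .A (t, 0))) ∈ I := by
    intro t
    obtain ⟨a, ha⟩ := hf.map_A (t, 0)
    rw [ha]
    exact a.1.2
  have hC : ∀ u v, coord₁ (f (pt .C (u, v))) = 2 + coord₁ (f (pt .A (u, 0))) :=
    fun u v => hf.coord₁_C_eq_A u unitInterval.nonneg'
  have hA : ∀ u v, coord₁ (f (pt .A (u, v))) = coord₁ (f (pt .A (u, 0))) := fun u v => by
    -- The single point `[C;(u,1)]` is comparable with `[A;(u,v)]` for every `v`, which removes the
    -- dependence on `v`.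
    have h1 := hf.coord₁_C_eq_A u (unitInterval.le_one' (t := v))
    rw [hC] at h1
    linarith
  refine ⟨fun t => ⟨coord₁ (f (pt .A (t, 0))), hmem t⟩, ?_, fun s t hst => ?_, fun t => ?_,
    fun x => hA x.1 x.2, fun x => hC x.1 x.2⟩
  · exact Continuous.subtype_mk
      (continuous_coord₁.comp (hc.comp ((continuous_pt _).comp (by fun_prop)))) _
  · have h1 := hf.coord₁_C_lt_A (x := (t, 0)) (y := (s, 0)) hst le_rfl
    rw [hC] at h1
    exact Subtype.coe_lt_coe.1 (by dsimp only; linarith)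
  · exact Subtype.coe_le_coe.1 (coord₁_le (hf.reach (pt .A (t, 0))))

lemma exists_coord₂ : ∃ g : I → I, Continuous g ∧ StrictMono g ∧ (∀ t, t ≤ g t) ∧
    (∀ x, coord₂ (f (pt .A x)) = g x.2) ∧ ∀ x, coord₂ (f (pt .C x)) = 2 + g x.2 := by
  obtain ⟨g, h1, h2, h3, h4, h5⟩ := hf.swap_conj.exists_coord₁
  exact ⟨g, h1, h2, h3, fun x => by simpa using h4 x.swap, fun x => by simpa using h5 x.swap⟩

/-- The form of `f` on `B₁`. -/
lemma map_B₁_eq {g : I → I} (hA : ∀ x, coord₂ (f (pt .A x)) = g x.2)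
    (hC : ∀ x, coord₂ (f (pt .C x)) = 2 + g x.2) (s t : I) :
    f (pt .B₁ (s, t)) = ptB₁C (coord₁ (f (pt .B₁ (s, t))) - 1) (g t) := by
  have h1 : 1 ≤ coord₁ (f (pt .B₁ (s, t))) := by
    have := coord₁_le (hf.reach (pt .B₁ (s, t)))
    rw [coord₁_B₁] at this
    linarith [s.2.1]
  obtain ⟨h2, h3⟩ : 0 ≤ side (f (pt .B₁ (s, t))) ∧ rowCoord (f (pt .B₁ (s, t))) = g t := by
    rcases (unitInterval.nonneg' (t := s)).eq_or_lt with rfl | hs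
    · rw [← glue_AB₁, ← hA (1, t), rowCoord, hf.height_eq_zero_iff.2 (height_A _)]
      exact ⟨((side_eq_zero_iff _).2 (.inl (hf.height_eq_zero_iff.2 (height_A _)))).ge, by ring⟩
    · obtain ⟨h2, h3⟩ := hf.map_B₁ (x := (s, t)) hs
      -- The second coordinate is squeezed between its values on the right edge, shared with `C`,
      -- and on the left edge, shared with `A`; both are `g t`.
      refine ⟨h3, le_antisymm ?_ ?_⟩
      · refine (rowCoord_le h2 h3 (hf.map_reach (reach_B₁_C (y := (0, t)) le_rfl))).2.trans ?_
        have := height_le_one (f (pt .C (0, t)))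
        have h4 := height_le (hf.reach (pt .C (0, t)))
        rw [height_C] at h4
        rw [rowCoord, hC]
        linarith
      · refine le_trans ?_ (hf.rowCoord_A_le_B₁ hs)
        rw [rowCoord, hA, hf.height_eq_zero_iff.2 (height_A _)]
        linarith
  have h4 := row_of_one_le (x := (coord₁ (f (pt .B₁ (s, t))), rowCoord (f (pt .B₁ (s, t))))) h1
  rwa [row_coord h2, h3, Set.projIcc_val] at h4

end Inessential

end Dubut

/-! ## Directed maps between intervals and squares -/

/-- A continuous non-decreasing function on the interval as a d-map. -/
def DMap.ofMonotone (g : I → I) (hc : Continuous g) (hm : Monotone g) : DMap I I where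
  toMap := ⟨g, hc⟩
  map_dPaths _ hp := fun _ _ h => hm (hp h)

/-- A continuous non-decreasing function on the square as a d-map to an interval. -/
def DMap.ofMonotoneSquare {a b : ℝ} (g : I × I → ℝ) (hc : Continuous g) (hm : Monotone g)
    (hg : ∀ x, g x ∈ Set.Icc a b) : DMap (I × I) (Set.Icc a b) where
  toMap := ⟨fun x => ⟨g x, hg x⟩, by fun_prop⟩
  map_dPaths _ hp := fun _ _ h => hm ⟨hp.1 h, hp.2 h⟩

/-- D-paths of intervals are the monotone paths, so an order isomorphism is a d-homeomorphism.
Surjectivity onto `[g 0, 1]` is the intermediate value theorem. -/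
lemma exists_dHomeo {g : I → I} (hc : Continuous g) (hm : StrictMono g) (h1 : g 1 = 1) :
    ∃ e : DHomeo I (Set.Icc (g 0 : ℝ) 1), ∀ t, (e.toHomeo t : ℝ) = g t := by
  let k : I → Set.Icc (g 0 : ℝ) 1 := fun t => ⟨g t, hm.monotone unitInterval.nonneg', (g t).2.2⟩
  have hk : StrictMono k := fun s t h => hm h
  have hs : Function.Surjective k := by
    rintro ⟨y, hy⟩
    obtain ⟨t, -, ht⟩ := intermediate_value_Icc (f := fun t => (g t : ℝ)) (zero_le_one (α := I))
      (by fun_prop) (by simpa [h1] using hy)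
    exact ⟨t, Subtype.ext ht⟩
  let e := hk.orderIsoOfSurjective k hs
  exact ⟨⟨e.toHomeomorph, fun p hp s t h => e.monotone (hp h),
    fun p hp s t h => e.symm.monotone (hp h)⟩, fun t => rfl⟩

namespace Dubut

/-! ## Regions of the complex -/

lemma swap_eq_iff {x y : Dubut} : swap x = y ↔ x = swap y :=
  ⟨fun h => by rw [← h, swap_swap], fun h => by rw [h, swap_swap]⟩

lemma preimage_swap_cell (c : Cell) : swap ⁻¹' cell c = cell c.swap := by
  ext z
  simp only [cell, Set.mem_preimage, Set.mem_range, eq_comm (b := swap z), swap_eq_iff, swap_pt,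
    eq_comm (b := z)]
  exact (Equiv.prodComm I I).exists_congr_left

lemma preimage_swap_a₁ : swap ⁻¹' a₁ = a₂ := by ext z; simp [a₁, a₂, swap_eq_iff]

lemma preimage_swap_b₁ : swap ⁻¹' b₁ = b₂ := by ext z; simp [b₁, b₂, swap_eq_iff]

lemma preimage_swap_c₂ : swap ⁻¹' c₂ = c₁ := by ext z; simp [c₁, c₂, swap_eq_iff]

lemma preimage_swap_c₁ : swap ⁻¹' c₁ = c₂ := by ext z; simp [c₁, c₂, swap_eq_iff]

lemma preimage_swap_aPlus : swap ⁻¹' {aPlus} = {aPlus} := by ext z; simp [aPlus, swap_eq_iff]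

lemma preimage_swap_cPlus : swap ⁻¹' {cPlus} = {cPlus} := by ext z; simp [cPlus, swap_eq_iff]

lemma preimage_swap_openB₁ : swap ⁻¹' openB₁ = openB₂ := by
  simp only [openB₁, openB₂, Set.preimage_sdiff, Set.preimage_union, preimage_swap_cell,
    preimage_swap_a₁, preimage_swap_b₁, preimage_swap_aPlus, Cell.swap]

lemma preimage_swap_openC : swap ⁻¹' openC = openC := by
  simp only [openC, Set.preimage_sdiff, Set.preimage_union, preimage_swap_cell,
    preimage_swap_c₁, preimage_swap_c₂, preimage_swap_cPlus, Cell.swap, Set.union_comm c₂]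

/-- Points of the quotient are told apart by applying coordinate functions, which avoids any
analysis of the gluing relation. -/
lemma mem_openA {z : Dubut} : z ∈ openA ↔ ∃ u v : I, u < 1 ∧ v < 1 ∧ z = pt .A (u, v) := by
  constructor
  · rintro ⟨⟨⟨u, v⟩, rfl⟩, h⟩
    simp only [Set.mem_union, not_or] at h
    obtain ⟨⟨h1, h2⟩, h3⟩ := h
    rcases (unitInterval.le_one' (t := u)).eq_or_lt with rfl | hu
    · rcases (unitInterval.le_one' (t := v)).eq_or_lt with rfl | hv
      · exact absurd rfl h3
      · exact absurd ⟨v, hv, rfl⟩ h1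
    · rcases (unitInterval.le_one' (t := v)).eq_or_lt with rfl | hv
      · exact absurd ⟨u, hu, rfl⟩ h2
      · exact ⟨u, v, hu, hv, rfl⟩
  · rintro ⟨u, v, hu, hv, rfl⟩
    refine ⟨⟨_, rfl⟩, ?_⟩
    rintro ((⟨t, -, h⟩ | ⟨t, -, h⟩) | h)
    · exact hu.ne (Subtype.ext (congrArg coord₁ h))
    · exact hv.ne (Subtype.ext (congrArg coord₂ h))
    · exact hu.ne (Subtype.ext (congrArg coord₁ h))

lemma mem_openC {z : Dubut} : z ∈ openC ↔ ∃ u v : I, u < 1 ∧ v < 1 ∧ z = pt .C (u, v) := by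
  constructor
  · rintro ⟨⟨⟨u, v⟩, rfl⟩, h⟩
    simp only [Set.mem_union, not_or] at h
    obtain ⟨⟨h1, h2⟩, h3⟩ := h
    rcases (unitInterval.le_one' (t := u)).eq_or_lt with rfl | hu
    · rcases (unitInterval.le_one' (t := v)).eq_or_lt with rfl | hv
      · exact absurd rfl h3
      · exact absurd ⟨v, hv, rfl⟩ h1
    · rcases (unitInterval.le_one' (t := v)).eq_or_lt with rfl | hv
      · exact absurd ⟨u, hu, rfl⟩ h2
      · exact ⟨u, v, hu, hv, rfl⟩
  · rintro ⟨u, v, hu, hv, rfl⟩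
    refine ⟨⟨_, rfl⟩, ?_⟩
    rintro ((⟨t, -, h⟩ | ⟨t, -, h⟩) | h)
    · exact hu.ne (Subtype.ext (add_left_cancel (congrArg coord₁ h)))
    · exact hv.ne (Subtype.ext (add_left_cancel (congrArg coord₂ h)))
    · exact hu.ne (Subtype.ext (add_left_cancel (congrArg coord₁ h)))

lemma mem_openB₁ {z : Dubut} : z ∈ openB₁ ↔ ∃ u v : I, 0 < u ∧ v < 1 ∧ z = pt .B₁ (u, v) := by
  constructor
  · rintro ⟨⟨⟨u, v⟩, rfl⟩, h⟩
    simp only [Set.mem_union, not_or] at h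
    obtain ⟨⟨h1, h2⟩, h3⟩ := h
    rcases (unitInterval.nonneg' (t := u)).eq_or_lt with rfl | hu
    · rw [← glue_AB₁] at h1 h3
      rcases (unitInterval.le_one' (t := v)).eq_or_lt with rfl | hv
      · exact absurd rfl h3
      · exact absurd ⟨v, hv, rfl⟩ h1
    · rcases (unitInterval.le_one' (t := v)).eq_or_lt with rfl | hv
      · exact absurd ⟨u, hu, rfl⟩ h2
      · exact ⟨u, v, hu, hv, rfl⟩
  · rintro ⟨u, v, hu, hv, rfl⟩
    refine ⟨⟨_, rfl⟩, ?_⟩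
    rintro ((⟨t, -, h⟩ | ⟨t, -, h⟩) | h)
    -- The height separates the point from the edge shared with `A`; below, `rowCoord` separates it
    -- from the top edge.
    · exact hu.ne' (Subtype.ext (congrArg height h))
    · have := congrArg rowCoord h
      rw [rowCoord_B₁, rowCoord_B₁] at this
      exact hv.ne (Subtype.ext this)
    · exact hu.ne' (Subtype.ext (congrArg height h))

/-- The strict bounds keep the point off the left edge of `B₁` and the right edge of `C`, as the
preserved regions require. -/
lemma ptB₁C_eq {u : ℝ} (h0 : 0 < u) (h2 : u < 2) (v : I) :
    (∃ s : I, 0 < s ∧ ptB₁C u v = pt .B₁ (s, v)) ∨ ∃ s : I, s < 1 ∧ ptB₁C u v = pt .C (s, v) := by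
  unfold ptB₁C
  split_ifs with h
  · rw [Set.projIcc_of_mem zero_le_one ⟨h0.le, h⟩]
    exact .inl ⟨_, h0, rfl⟩
  · rw [Set.projIcc_of_mem zero_le_one ⟨by linarith, by linarith⟩]
    exact .inr ⟨_, Subtype.coe_lt_coe.1 (by simp only [Set.Icc.coe_one]; linarith), rfl⟩

lemma swap_ptB₁C (u : ℝ) (v : I) : swap (ptB₁C u v) = ptB₂C v u := by
  unfold ptB₁C ptB₂C
  split_ifs <;> rfl

lemma mapsTo_of_swap_conj {f : Dubut → Dubut} {S T : Set Dubut} (h : Set.MapsTo (swap ∘ f ∘ swap) S S)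
    (hST : swap ⁻¹' S = T) :
    Set.MapsTo f T T := by
  subst hST
  intro z hz
  simpa using h hz

namespace Inessential

variable {f : Dubut → Dubut} (hf : Inessential f)
include hf

/-- The form of `f` on `B₁`, with the first coordinate as a d-map. -/
lemma exists_dMap_B₁ {g₁ g₂ : I → I} (h1 : g₁ 1 = 1) (hA₁ : ∀ x, coord₁ (f (pt .A x)) = g₁ x.1)
    (hC₁ : ∀ x, coord₁ (f (pt .C x)) = 2 + g₁ x.1) (hA₂ : ∀ x, coord₂ (f (pt .A x)) = g₂ x.2)
    (hC₂ : ∀ x, coord₂ (f (pt .C x)) = 2 + g₂ x.2) :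
    ∃ G : DMap (I × I) (Set.Icc 0 (1 + (g₁ 0 : ℝ))),
      (∀ t, (G (0, t) : ℝ) = 0) ∧ (∀ t, (G (1, t) : ℝ) = 1 + g₁ 0) ∧
      (∀ s t : I, (s : ℝ) ≤ G (s, t)) ∧
      ∀ s t, f (pt .B₁ (s, t)) = ptB₁C (G (s, t)) (g₂ t) := by
  have hle : ∀ x : I × I, (x.1 : ℝ) ≤ coord₁ (f (pt .B₁ x)) - 1 := fun x => by
    have := coord₁_le (hf.reach (pt .B₁ x))
    rw [coord₁_B₁] at this
    linarith
  refine ⟨.ofMonotoneSquare (fun x => coord₁ (f (pt .B₁ x)) - 1) ?_ (fun x y h => ?_)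
    (fun x => ⟨x.1.2.1.trans (hle x), ?_⟩), fun t => ?_, fun t => ?_, fun s t => hle (s, t),
    hf.map_B₁_eq hA₂ hC₂⟩
  · exact (continuous_coord₁.comp (hf.continuous.comp (continuous_pt _))).sub continuous_const
  · exact sub_le_sub_right (coord₁_le (hf.map_reach (reach_B₁_B₁ h))) 1
  -- The upper bound `1 + g₁ 0` comes from the point of the right edge of `B₁` at the same level,
  -- viewed as a point of `C`.
  · have := coord₁_le (hf.map_reach (reach_B₁_C (x := x) (y := (0, x.2)) le_rfl))
    rw [hC₁] at this
    linarith
  · change coord₁ (f (pt .B₁ (0, t))) - 1 = 0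
    rw [← glue_AB₁, hA₁, h1]
    simp
  · change coord₁ (f (pt .B₁ (1, t))) - 1 = _
    rw [glue_B₁C, hC₁]
    ring

lemma map_A_eq {g₁ g₂ : I → I} (h₁ : ∀ x, coord₁ (f (pt .A x)) = g₁ x.1)
    (h₂ : ∀ x, coord₂ (f (pt .A x)) = g₂ x.2) (x : I × I) :
    f (pt .A x) = pt .A (g₁ x.1, g₂ x.2) := by
  obtain ⟨y, hy⟩ := hf.map_A x
  rw [hy, show y = (g₁ x.1, g₂ x.2) from Prod.ext (Subtype.ext (by rw [← h₁, hy, coord₁_A]))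
    (Subtype.ext (by rw [← h₂, hy, coord₂_A]))]

lemma map_C_eq {g₁ g₂ : I → I} (h₁ : ∀ x, coord₁ (f (pt .C x)) = 2 + g₁ x.1)
    (h₂ : ∀ x, coord₂ (f (pt .C x)) = 2 + g₂ x.2) (x : I × I) :
    f (pt .C x) = pt .C (g₁ x.1, g₂ x.2) := by
  obtain ⟨y, hy⟩ := hf.map_C x
  rw [hy, show y = (g₁ x.1, g₂ x.2) from Prod.ext
    (Subtype.ext (add_left_cancel ((h₁ x).symm.trans (by rw [hy, coord₁_C])).symm))
    (Subtype.ext (add_left_cancel ((h₂ x).symm.trans (by rw [hy, coord₂_C])).symm))]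

/-- Regions preserved by `f`; their mirror images are preserved by symmetry. -/
lemma mapsTo₁ : Set.MapsTo f a₁ a₁ ∧
    Set.MapsTo f (openB₁ ∪ b₁ ∪ cell .C) (openB₁ ∪ b₁ ∪ cell .C) ∧
    Set.MapsTo f (b₁ ∪ c₂) (b₁ ∪ c₂) ∧ Set.MapsTo f (openB₁ ∪ openC) (openB₁ ∪ openC) := by
  obtain ⟨g₁, hc₁, hm₁, hl₁, hA₁, hC₁⟩ := hf.exists_coord₁
  obtain ⟨g₂, hc₂, hm₂, hl₂, hA₂, hC₂⟩ := hf.exists_coord₂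
  have h1₁ : g₁ 1 = 1 := le_antisymm unitInterval.le_one' (hl₁ 1)
  have h1₂ : g₂ 1 = 1 := le_antisymm unitInterval.le_one' (hl₂ 1)
  have lt₁ : ∀ {t}, t < 1 → g₁ t < 1 := fun h => (hm₁ h).trans_eq h1₁
  have lt₂ : ∀ {t}, t < 1 → g₂ t < 1 := fun h => (hm₂ h).trans_eq h1₂
  have hB : ∀ {s t : I}, 0 < s → (∃ r : I, 0 < r ∧ f (pt .B₁ (s, t)) = pt .B₁ (r, g₂ t)) ∨
      ∃ r : I, r < 1 ∧ f (pt .B₁ (s, t)) = pt .C (r, g₂ t) := by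
    intro s t hs
    obtain ⟨G, -, -, h3, h4⟩ := hf.exists_dMap_B₁ h1₁ hA₁ hC₁ hA₂ hC₂
    rw [h4]
    -- The bound `G < 2` holds because `G ≤ 1 + g₁ 0` and `g₁ 0 < g₁ 1 = 1`.
    refine ptB₁C_eq (lt_of_lt_of_le hs (h3 s t)) ((G (s, t)).2.2.trans_lt ?_) _
    have : (g₁ 0 : ℝ) < 1 := lt₁ zero_lt_one
    linarith
  refine ⟨?_, ?_, ?_, ?_⟩
  · rintro _ ⟨t, ht, rfl⟩
    rw [hf.map_A_eq hA₁ hA₂, h1₁]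
    exact ⟨_, lt₂ ht, rfl⟩
  · have key : ∀ {s t : I}, 0 < s → pt .B₁ (s, t) ∈ openB₁ ∪ b₁ ∪ cell .C := by
      intro s t hs
      rcases (unitInterval.le_one' (t := t)).eq_or_lt with rfl | ht
      · exact .inl (.inr ⟨s, hs, rfl⟩)
      · exact .inl (.inl (mem_openB₁.2 ⟨s, t, hs, ht, rfl⟩))
    have key' : ∀ {s t : I}, 0 < s → f (pt .B₁ (s, t)) ∈ openB₁ ∪ b₁ ∪ cell .C := by
      intro s t hs
      rcases hB (t := t) hs with ⟨r, hr, h⟩ | ⟨r, -, h⟩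
      · exact h ▸ key hr
      · exact .inr ⟨_, h.symm⟩
    rintro z ((hz | ⟨t, ht, rfl⟩) | ⟨x, rfl⟩)
    · obtain ⟨u, v, hu, -, rfl⟩ := mem_openB₁.1 hz
      exact key' hu
    · exact key' ht
    · exact .inr ⟨_, (hf.map_C_eq hC₁ hC₂ x).symm⟩
  · rintro z (⟨t, ht, rfl⟩ | ⟨t, ht, rfl⟩)
    · rcases hB (t := 1) ht with ⟨r, hr, h⟩ | ⟨r, hr, h⟩ <;> rw [h1₂] at h
      · exact .inl ⟨r, hr, h⟩
      · exact .inr ⟨r, hr, h⟩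
    · rw [hf.map_C_eq hC₁ hC₂, h1₂]
      exact .inr ⟨_, lt₁ ht, rfl⟩
  · rintro z (hz | hz)
    · obtain ⟨u, v, hu, hv, rfl⟩ := mem_openB₁.1 hz
      rcases hB (t := v) hu with ⟨r, hr, h⟩ | ⟨r, hr, h⟩
      · exact .inl (mem_openB₁.2 ⟨r, _, hr, lt₂ hv, h⟩)
      · exact .inr (mem_openC.2 ⟨r, _, hr, lt₂ hv, h⟩)
    · obtain ⟨u, v, hu, hv, rfl⟩ := mem_openC.1 hz
      exact .inr (mem_openC.2 ⟨_, _, lt₁ hu, lt₂ hv, hf.map_C_eq hC₁ hC₂ _⟩)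

end Inessential

end Dubut

end DirectedTop

/-! ### Assembly of the theorem -/

theorem mainTheorem9 (F : CategoryTheory.MorphismProperty TopCat.{0})
    (hF : F ≤ DirectedTop.pi0Bijective)
    (f : DirectedTop.DMap DirectedTop.Dubut DirectedTop.Dubut)
    (hf : DirectedTop.IsFutureInessential F f) :
    -- (1) regions preserved by `f`
    (DirectedTop.Preserves f (DirectedTop.cell .A) ∧
      DirectedTop.Preserves f DirectedTop.a₁ ∧
      DirectedTop.Preserves f DirectedTop.a₂ ∧
      DirectedTop.Preserves f {DirectedTop.aPlus} ∧
      DirectedTop.Preserves f (DirectedTop.cell .A)ᶜ ∧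
      DirectedTop.Preserves f (DirectedTop.cell .C) ∧
      DirectedTop.Preserves f (DirectedTop.openB₁ ∪ DirectedTop.b₁ ∪ DirectedTop.cell .C) ∧
      DirectedTop.Preserves f (DirectedTop.openB₂ ∪ DirectedTop.b₂ ∪ DirectedTop.cell .C)) ∧
    -- (2)-(5) the form of `f` on the four cells
    (∃ (φ : unitInterval × unitInterval → unitInterval × unitInterval)
      (f₁ f₂ : DirectedTop.DMap unitInterval unitInterval) (d₁ d₂ : ℝ),
      -- (2) the restrictions to `A` and `C` agree
      (∀ x, f (DirectedTop.pt .A x) = DirectedTop.pt .A (φ x) ∧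
        f (DirectedTop.pt .C x) = DirectedTop.pt .C (φ x)) ∧
      -- (3) they are the product of `f₁` and `f₂`
      (∀ x₁ x₂, φ (x₁, x₂) = (f₁ x₁, f₂ x₂)) ∧
      (∀ t, t ≤ f₁ t) ∧ (∀ t, t ≤ f₂ t) ∧
      -- (4) `f₁`, `f₂` are d-homeomorphisms onto `[d₁, 1]`, `[d₂, 1]`
      (0 ≤ d₁ ∧ d₁ < 1 ∧ ∃ e : DirectedTop.DHomeo unitInterval (Set.Icc d₁ 1),
        ∀ t, (e.toHomeo t : ℝ) = f₁ t) ∧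
      (0 ≤ d₂ ∧ d₂ < 1 ∧ ∃ e : DirectedTop.DHomeo unitInterval (Set.Icc d₂ 1),
        ∀ t, (e.toHomeo t : ℝ) = f₂ t) ∧
      -- (5) the form on `B₁` and on `B₂`
      (∃ g₁ : DirectedTop.DMap (unitInterval × unitInterval) (Set.Icc 0 (1 + d₁)),
        (∀ t, (g₁ (0, t) : ℝ) = 0) ∧ (∀ t, (g₁ (1, t) : ℝ) = 1 + d₁) ∧
        (∀ s t : unitInterval, (s : ℝ) ≤ g₁ (s, t)) ∧
        ∀ x₁ x₂, f (DirectedTop.pt .B₁ (x₁, x₂)) = DirectedTop.ptB₁C (g₁ (x₁, x₂)) (f₂ x₂)) ∧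
      (∃ g₂ : DirectedTop.DMap (unitInterval × unitInterval) (Set.Icc 0 (1 + d₂)),
        (∀ t, (g₂ (t, 0) : ℝ) = 0) ∧ (∀ t, (g₂ (t, 1) : ℝ) = 1 + d₂) ∧
        (∀ s t : unitInterval, (t : ℝ) ≤ g₂ (s, t)) ∧
        ∀ x₁ x₂, f (DirectedTop.pt .B₂ (x₁, x₂)) = DirectedTop.ptB₂C (f₁ x₁) (g₂ (x₁, x₂)))) ∧
    -- (6) further regions preserved by `f`
    (DirectedTop.Preserves f DirectedTop.openA ∧
      DirectedTop.Preserves f {DirectedTop.cPlus} ∧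
      DirectedTop.Preserves f (DirectedTop.b₁ ∪ DirectedTop.c₂) ∧
      DirectedTop.Preserves f (DirectedTop.b₂ ∪ DirectedTop.c₁) ∧
      DirectedTop.Preserves f (DirectedTop.openB₁ ∪ DirectedTop.openC) ∧
      DirectedTop.Preserves f (DirectedTop.openB₂ ∪ DirectedTop.openC)) := by
  have hf := hf.inessential hF
  obtain ⟨g₁, hc₁, hm₁, hl₁, hA₁, hC₁⟩ := hf.exists_coord₁
  obtain ⟨g₂, hc₂, hm₂, hl₂, hA₂, hC₂⟩ := hf.exists_coord₂
  have h1₁ : g₁ 1 = 1 := le_antisymm unitInterval.le_one' (hl₁ 1)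
  have h1₂ : g₂ 1 = 1 := le_antisymm unitInterval.le_one' (hl₂ 1)
  have lt₁ : ∀ {t}, t < 1 → g₁ t < 1 := fun h => (hm₁ h).trans_eq h1₁
  have lt₂ : ∀ {t}, t < 1 → g₂ t < 1 := fun h => (hm₂ h).trans_eq h1₂
  have hA := hf.map_A_eq hA₁ hA₂
  have hC := hf.map_C_eq hC₁ hC₂
  obtain ⟨p₁, p₂, p₃, p₄⟩ := hf.mapsTo₁
  obtain ⟨q₁, q₂, q₃, q₄⟩ := hf.swap_conj.mapsTo₁
  refine ⟨⟨?_, p₁, DirectedTop.Dubut.mapsTo_of_swap_conj q₁ DirectedTop.Dubut.preimage_swap_a₁, ?_, ?_, ?_, p₂,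
      DirectedTop.Dubut.mapsTo_of_swap_conj q₂ ?_⟩,
    ⟨fun x => (g₁ x.1, g₂ x.2), .ofMonotone g₁ hc₁ hm₁.monotone, .ofMonotone g₂ hc₂ hm₂.monotone,
      g₁ 0, g₂ 0, fun x => ⟨hA x, hC x⟩, fun _ _ => rfl, hl₁, hl₂,
      ⟨(g₁ 0).2.1, lt₁ zero_lt_one, DirectedTop.exists_dHomeo hc₁ hm₁ h1₁⟩,
      ⟨(g₂ 0).2.1, lt₂ zero_lt_one, DirectedTop.exists_dHomeo hc₂ hm₂ h1₂⟩,
      hf.exists_dMap_B₁ h1₁ hA₁ hC₁ hA₂ hC₂, ?_⟩,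
    ?_, ?_, p₃, DirectedTop.Dubut.mapsTo_of_swap_conj q₃ ?_, p₄, DirectedTop.Dubut.mapsTo_of_swap_conj q₄ ?_⟩
  · rintro _ ⟨x, rfl⟩
    exact ⟨_, (hA x).symm⟩
  · rintro _ rfl
    exact (hA (1, 1)).trans (by rw [h1₁, h1₂]; rfl)
  -- Preservation of the complement of `A` is the direction of `height_eq_zero_iff` saying that `f`
  -- sends no point outside `A` into `A`.
  · rintro z hz ⟨x, hx⟩
    obtain ⟨y, rfl⟩ := DirectedTop.Dubut.height_eq_zero_iff.1
      (hf.height_eq_zero_iff.1 (DirectedTop.Dubut.height_eq_zero_iff.2 ⟨x, hx.symm⟩))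
    exact hz ⟨y, rfl⟩
  · rintro _ ⟨x, rfl⟩
    exact ⟨_, (hC x).symm⟩
  · simp only [Set.preimage_union, DirectedTop.Dubut.preimage_swap_openB₁, DirectedTop.Dubut.preimage_swap_b₁,
      DirectedTop.Dubut.preimage_swap_cell, DirectedTop.Cell.swap]
  -- The form on `B₂` is the form of the conjugate map on `B₁`: `g₁` and `g₂` exchange roles, and
  -- the arguments of `G` are then swapped back.
  · obtain ⟨G, h1, h2, h3, h4⟩ := hf.swap_conj.exists_dMap_B₁ (g₁ := g₂) (g₂ := g₁) h1₂
      (fun x => (DirectedTop.Dubut.coord₁_swap _).trans (hA₂ x.swap))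
      (fun x => (DirectedTop.Dubut.coord₁_swap _).trans (hC₂ x.swap))
      (fun x => (DirectedTop.Dubut.coord₂_swap _).trans (hA₁ x.swap))
      (fun x => (DirectedTop.Dubut.coord₂_swap _).trans (hC₁ x.swap))
    refine ⟨⟨G.toMap.comp ⟨Prod.swap, continuous_swap⟩,
      fun p hp => G.map_dPaths (.comp ⟨Prod.swap, continuous_swap⟩ p) ⟨hp.2, hp.1⟩⟩,
      h1, h2, fun s t => h3 t s, fun s t => ?_⟩
    exact (DirectedTop.Dubut.swap_eq_iff.1 (h4 t s)).trans (DirectedTop.Dubut.swap_ptB₁C _ _)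
  · intro z hz
    obtain ⟨u, v, hu, hv, rfl⟩ := DirectedTop.Dubut.mem_openA.1 hz
    exact DirectedTop.Dubut.mem_openA.2 ⟨_, _, lt₁ hu, lt₂ hv, hA _⟩
  · rintro _ rfl
    exact hf.map_cPlus
  · rw [Set.preimage_union, DirectedTop.Dubut.preimage_swap_b₁, DirectedTop.Dubut.preimage_swap_c₂]
  · rw [Set.preimage_union, DirectedTop.Dubut.preimage_swap_openB₁, DirectedTop.Dubut.preimage_swap_openC]
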